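/- We work over $\mathbb{C}$. Let $V$ be a finite-dimensional complex vector space and $X\subset\mathbb{P}V$ an irreducible nondegenerate projective subvariety. For a point $P$ let $\widehat P\subset V$ be the corresponding line, and for a nonsingular point $P$ of $X$ let $T_P(\widehat X)\subset V$ be the affine tangent space, $T_PX=\mathrm{Hom}(\widehat P,T_P(\widehat X)/\widehat P)$ the tangent space and $N_P=(T_P\mathbb{P}V)/T_PX=\mathrm{Hom}(\widehat P,V/T_P(\widehat X))$ the normal space. The second fundamental form of $X$ at $P$ is the derivative at $P$ of the Gauss map $Q\mapsto T_Q(\widehat X)$; it gives a linear map $\sigma:\mathrm{Sym}^2T_PX\to N_P$, whose associated linear system of quadrics on $T_PX$ is $|{\rm II}_{P,X}|=\{\xi(\sigma(u,u)):\xi\in N_P^*\}$. A *quadratic symmetry* of $X$ at $P$ is a linear $\mathbb{C}^*$-action $E_P$ on $V$ such that $V=\widehat P\oplus T'\oplus N'$ with $T_P(\widehat X)=\widehat P\oplus T'$ for some subspaces $T',N'$ on which $\lambda\in\mathbb{C}^*$ acts by $(t,u,w)\mapsto(t,\lambda u,\lambda^2w)$, and such that the induced action on $\mathbb{P}V$ preserves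 $X$. The variety $X$ is *quadratically symmetric* if there is a non-empty Zariski open subset $X^o$ of its nonsingular locus such that a quadratic symmetry exists at every $P\in X^o$. For a surjective linear map $\sigma:\mathrm{Sym}^2U\to W$, let $Z(\sigma)\subset\mathbb{P}(\mathbb{C}\oplus U\oplus W)$ be the Zariski closure of the image of the rational map $[t:u]\mapsto[t^2:tu:\sigma(u,u)]$ on $\mathbb{P}(\mathbb{C}\oplus U)$. Then the following hold. (1) Let $X\subset\mathbb{P}V$ be quadratically symmetric, with $X^o$ as above, and let $P\in X^o$. The second fundamental form $\sigma:\mathrm{Sym}^2T_PX\to N_P$ of $X$ at $P$ is well defined and surjective, and $X$ is projectively equivalent to $Z(\sigma)$. (2) In the situation of (1), let $E_P$ be any quadratic symmetry of $X$ at $P$, and let $(x_0,x_1,\dots,x_N)$ be linear coordinates on $V$ such that $E_P^\lambda$ multiplies $x_0$ by $1$, $x_1,\dots,x_n$ by $\lambda$ and $x_{n+1},\dots,x_N$ by $\lambda^2$ (so that $n=\dim X$). In the inhomogeneous coordinates $z_i=x_i/x_0$, which are centered at $P$, the germ of $X$ at $P$ is the graph $z_k=F^k(z_1,\dots,z_n)$,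 $n+1\le k\le N$, of the germ of a holomorphic map; the $F^k$ are homogeneous quadratic polynomials; and, under the identification $T_P^*X=\mathbb{C}z_1+\dots+\mathbb{C}z_n$, the system of quadrics on $T_PX$ spanned by the $F^k$ is the second fundamental form $|{\rm II}_{P,X}|$. (3) Let $X_1,X_2\subset\mathbb{P}V$ be quadratically symmetric varieties and $P_i\in X_i^o$ points such that $|{\rm II}_{P_1,X_1}|$ and $|{\rm II}_{P_2,X_2}|$ are isomorphic as systems of quadrics, i.e. identified by some linear isomorphism $T_{P_1}X_1\cong T_{P_2}X_2$ (so in particular $\dim X_1=\dim X_2$). Then $X_1$ and $X_2$ are projectively equivalent. -/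

import Mathlib

open LinearAlgebra.Projectivization Topology

namespace QuadSym

section Algebraic

variable {V V' U U' W W' : Type*}
  [AddCommGroup V] [Module ℂ V] [AddCommGroup V'] [Module ℂ V']
  [AddCommGroup U] [Module ℂ U] [AddCommGroup U'] [Module ℂ U']
  [AddCommGroup W] [Module ℂ W] [AddCommGroup W'] [Module ℂ W']

/-- `f` is a homogeneous polynomial function of degree `d` on `V`, i.e. a homogeneous polynomial
expression of degree `d` in linear functionals on `V`. -/
def IsForm (d : ℕ) (f : V → ℂ) : Prop :=
  ∃ p : MvPolynomial (Module.Dual ℂ V) ℂ, p.IsHomogeneous d ∧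
    ∀ v, f v = MvPolynomial.eval (fun l : Module.Dual ℂ V => l v) p

/-- The function `f` vanishes on the line in `V` represented by the point `P` of `ℙ V`. -/
def VanishesAt (f : V → ℂ) (P : ℙ ℂ V) : Prop :=
  ∀ v ∈ P.submodule, f v = 0

/-- The Zariski topology on `ℙ V`, generated by the basic open sets `f ≠ 0` for `f` a homogeneous
polynomial function. -/
instance zariskiTopology : TopologicalSpace (ℙ ℂ V) :=
  TopologicalSpace.generateFrom
    {O | ∃ (d : ℕ) (f : V → ℂ), IsForm d f ∧ O = {P | ¬ VanishesAt f P}}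

/-- An irreducible nondegenerate projective subvariety of `ℙ V`: a Zariski closed irreducible (in
particular non-empty) subset that is not contained in a hyperplane. -/
structure IsNondegenerateVariety (X : Set (ℙ ℂ V)) : Prop where
  isClosed : IsClosed X
  irreducible : IsIrreducible X
  nondegenerate : ∀ l : Module.Dual ℂ V, (∀ P ∈ X, VanishesAt l P) → l = 0

/-- The affine cone over `X`. -/
def affineCone (X : Set (ℙ ℂ V)) : Set V :=
  {v | ∃ P ∈ X, v ∈ P.submodule}

/-- Two subsets of projective spaces are projectively equivalent: some linear isomorphism of the
underlying vector spaces carries one onto the other. -/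
def ProjectivelyEquivalent (X : Set (ℙ ℂ V)) (Y : Set (ℙ ℂ V')) : Prop :=
  ∃ g : V ≃ₗ[ℂ] V', Projectivization.map (g : V →ₗ[ℂ] V') g.injective '' X = Y

/-- The variety `Z(σ) ⊆ ℙ (ℂ ⊕ U ⊕ W)`: the Zariski closure of the image of the rational map
`[t : u] ↦ [t² : t u : σ(u, u)]`. -/
def quadricImage (σ : U →ₗ[ℂ] U →ₗ[ℂ] W) : Set (ℙ ℂ (ℂ × U × W)) :=
  closure {Q | ∃ (t : ℂ) (u : U), (t ^ 2, t • u, σ u u) ≠ (0 : ℂ × U × W) ∧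
    (t ^ 2, t • u, σ u u) ∈ Q.submodule}

/-- The linear system of quadrics `{ξ(σ(u, u)) : ξ ∈ W*}` on `U` given by a bilinear map `σ`. -/
noncomputable def quadricSystem (σ : U →ₗ[ℂ] U →ₗ[ℂ] W) : Submodule ℂ (QuadraticForm ℂ U) :=
  Submodule.span ℂ {q | ∃ ξ : Module.Dual ℂ W, ∀ u, q u = ξ (σ u u)}

/-- The systems of quadrics on `U` and `U'` given by `σ` and `σ'` are isomorphic: a linear
isomorphism `U ≃ U'` identifies the two linear systems. -/
def SystemsIsomorphic (σ : U →ₗ[ℂ] U →ₗ[ℂ] W) (σ' : U' →ₗ[ℂ] U' →ₗ[ℂ] W') : Prop :=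
  ∃ τ : U ≃ₗ[ℂ] U', ∀ q : QuadraticForm ℂ U',
    q ∈ quadricSystem σ' ↔ q.comp (τ : U →ₗ[ℂ] U') ∈ quadricSystem σ

end Algebraic

section Tangent

variable {V : Type*} [NormedAddCommGroup V] [NormedSpace ℂ V]

/-- The affine tangent space `T_P(X̂) ⊆ V` at `P`: the common kernel of the differentials, at the
points of the line over `P`, of all homogeneous polynomials vanishing on `X`. -/
noncomputable def affineTangent (X : Set (ℙ ℂ V)) (P : ℙ ℂ V) : Submodule ℂ V :=
  ⨅ (f : V → ℂ) (_ : (∃ d, IsForm d f) ∧ ∀ Q ∈ X, VanishesAt f Q) (v : V) (_ : v ∈ P.submodule),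
    LinearMap.ker (fderiv ℂ f v : V →ₗ[ℂ] ℂ)

/-- `P` is a nonsingular point of `X`: on a Zariski neighbourhood of `P`, the set `X` is cut out by
homogeneous polynomials vanishing on `X` whose differentials are linearly independent at `P`. -/
def IsNonsingularPoint (X : Set (ℙ ℂ V)) (P : ℙ ℂ V) : Prop :=
  P ∈ X ∧ ∃ (m : ℕ) (f : Fin m → V → ℂ) (O : Set (ℙ ℂ V)),
    (∀ i, (∃ d, IsForm d (f i)) ∧ ∀ Q ∈ X, VanishesAt (f i) Q) ∧
    (∀ v ∈ P.submodule, v ≠ 0 → LinearIndependent ℂ (fun i => fderiv ℂ (f i) v)) ∧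
    IsOpen O ∧ P ∈ O ∧ ∀ Q ∈ O, (∀ i, VanishesAt (f i) Q) → Q ∈ X

/-- The tangent space `T_P X = Hom(P̂, T_P(X̂) / P̂)` of `X` at a nonsingular point `P`, where `P̂` is
the line over `P`. -/
abbrev TangentSpaceAt (X : Set (ℙ ℂ V)) (P : ℙ ℂ V) : Type _ :=
  P.submodule →ₗ[ℂ] (affineTangent X P ⧸ P.submodule.submoduleOf (affineTangent X P))

/-- The normal space `T_P(ℙ V) / T_P X = Hom(P̂, V / T_P(X̂))` of `X` at a nonsingular point `P`. -/
abbrev NormalSpaceAt (X : Set (ℙ ℂ V)) (P : ℙ ℂ V) : Type _ :=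
  P.submodule →ₗ[ℂ] (V ⧸ affineTangent X P)

/-- `σ` is the second fundamental form of `X` at `P`, the derivative of the Gauss map
`Q ↦ T_Q(X̂)`, seen as a bilinear map from the tangent space to the normal space: if `y` is a
holomorphic curve germ in the affine cone starting at `p ∈ P̂ \ {0}`, moving in the direction
of `a`, and `w` is a holomorphic germ of vectors with `w(t)` in the affine tangent space at `y(t)`
and `w(0)` representing `b`, then `σ(a, b)(p)` is the class of `w'(0)`. -/
def IsSecondFundamentalForm (X : Set (ℙ ℂ V)) (P : ℙ ℂ V)
    (σ : TangentSpaceAt X P →ₗ[ℂ] TangentSpaceAt X P →ₗ[ℂ] NormalSpaceAt X P) : Prop :=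
  ∀ (a b : TangentSpaceAt X P) (p : P.submodule) (u w₀ : affineTangent X P) (y w : ℂ → V),
    p ≠ 0 → AnalyticAt ℂ y 0 → AnalyticAt ℂ w 0 →
    (∀ᶠ t in 𝓝 (0 : ℂ), ∃ Q ∈ X, y t ∈ Q.submodule ∧ w t ∈ affineTangent X Q) →
    y 0 = p → deriv y 0 = u → w 0 = w₀ →
    a p = Submodule.Quotient.mk u → b p = Submodule.Quotient.mk w₀ →
    σ a b p = Submodule.Quotient.mk (deriv w 0)

/-- `E` is a linear `ℂ*`-action on `V` of weight `0` on `P̂`, weight `1` on `T_P(X̂) / P̂` and weight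
`2` on `V / T_P(X̂)`, and the induced action on `ℙ V` preserves `X`. -/
def IsQuadraticSymmetry (X : Set (ℙ ℂ V)) (P : ℙ ℂ V) (E : ℂˣ →* (V ≃ₗ[ℂ] V)) : Prop :=
  (∃ T' N' : Submodule ℂ V,
    Disjoint P.submodule T' ∧ P.submodule ⊔ T' = affineTangent X P ∧
    IsCompl (affineTangent X P) N' ∧
    ∀ c : ℂˣ, (∀ v ∈ P.submodule, E c v = v) ∧ (∀ v ∈ T', E c v = (c : ℂ) • v) ∧
      (∀ v ∈ N', E c v = (c : ℂ) ^ 2 • v)) ∧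
  ∀ c : ℂˣ, Projectivization.map (E c : V →ₗ[ℂ] V) (E c).injective '' X = X

/-- `X` is a quadratically symmetric variety, as witnessed by the non-empty Zariski open subset `Xo`
of its nonsingular locus. -/
structure IsQuadraticallySymmetric (X Xo : Set (ℙ ℂ V)) : Prop where
  variety : IsNondegenerateVariety X
  isOpen : ∃ O : Set (ℙ ℂ V), IsOpen O ∧ Xo = X ∩ O
  nonempty : Xo.Nonempty
  nonsingular : ∀ P ∈ Xo, IsNonsingularPoint X P
  symmetric : ∀ P ∈ Xo, ∃ E : ℂˣ →* (V ≃ₗ[ℂ] V), IsQuadraticSymmetry X P E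

/-- Linear coordinates `e = (x₀, (x₁, …, xₙ), (xₙ₊₁, …, xₙ₊ₘ))` on `V` are adapted to the
`ℂ*`-action `E`: they have weights `0`, `1` and `2`. -/
def AdaptedCoordinates {n m : ℕ} (E : ℂˣ →* (V ≃ₗ[ℂ] V))
    (e : V ≃ₗ[ℂ] ℂ × (Fin n → ℂ) × (Fin m → ℂ)) : Prop :=
  ∀ (c : ℂˣ) (v : V), e (E c v) = ((e v).1, (c : ℂ) • (e v).2.1, (c : ℂ) ^ 2 • (e v).2.2)

/-- In the inhomogeneous coordinates `zᵢ = xᵢ / x₀` attached to `e`, the germ of `X` at the origin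
is the graph of the germ at `0` of the holomorphic map `F`. -/
def IsGraphGerm {n m : ℕ} (X : Set (ℙ ℂ V)) (e : V ≃ₗ[ℂ] ℂ × (Fin n → ℂ) × (Fin m → ℂ))
    (F : (Fin n → ℂ) → (Fin m → ℂ)) : Prop :=
  AnalyticAt ℂ F 0 ∧
    ∀ᶠ z in 𝓝 (0 : (Fin n → ℂ) × (Fin m → ℂ)),
      e.symm (1, z.1, z.2) ∈ affineCone X ↔ z.2 = F z.1

/-- `τ` is the identification of `T_P X` with `ℂⁿ` given by the differentials at `P` of the
inhomogeneous coordinates `zᵢ = xᵢ / x₀`, `1 ≤ i ≤ n`, attached to `e` (which are centred at `P`):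
on a tangent vector `a` sending `p ∈ P̂` to the class of `u`, one has `dzᵢ(a) = xᵢ(u) / x₀(p)`. -/
def IsCoordinateIdentification {n m : ℕ} (X : Set (ℙ ℂ V)) (P : ℙ ℂ V)
    (e : V ≃ₗ[ℂ] ℂ × (Fin n → ℂ) × (Fin m → ℂ))
    (τ : TangentSpaceAt X P ≃ₗ[ℂ] (Fin n → ℂ)) : Prop :=
  ∀ (a : TangentSpaceAt X P) (p : P.submodule) (u : affineTangent X P),
    a p = Submodule.Quotient.mk u → (e (u : V)).2.1 = (e (p : V)).1 • τ a

end Tangent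

end QuadSym

/-!
Let `P ∈ Xᵒ`, and split `V = ℂ ⊕ U ⊕ W` into the weight spaces of a quadratic symmetry at `P`, so
that `P = [1 : 0 : 0]` and the affine tangent space is `ℂ ⊕ U`. The whole statement follows from one
fact: the part of `X` with `x₀ = 1` is exactly the graph of a map `u ↦ B(u, u)` with `B` symmetric
bilinear (`IsQuadraticFrame.exists_graph`).

* The graph contains the affine part of `X` (`IsQuadraticFrame.exists_bilin`). If a form `f` vanishes
  on `X` and `(1, u, w)` lies on the cone, then `f(1, cu, c²w) = 0` for all `c`, and the coefficient of
  `c²` says that `df_P(w)` is a quadratic function of `u`. By definition of the affine tangent space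
  the functionals `df_P` have no common zero in `W`, so they span the dual of `W`, and `w` itself is a
  quadratic function of `u`.
* The affine part of `X` contains the graph. Local equations of `X` at a nonsingular point, together
  with `x₀` and `u`, form a submersion, so `X` has a point over every small `u`
  (`IsQuadraticFrame.eventually_exists_mem`); that point is on the graph, and the action spreads this
  to all `u`.

As `X` is irreducible, it is the Zariski closure of the graph, hence projectively equivalent to
`Z(2B)` (`IsQuadraticGraph.projectivelyEquivalent`). Differentiating the equations
`x₀ ξ(w) = ξ(B(u, u))` identifies `2B` with the second fundamental form
(`IsQuadraticFrame.isSecondFundamentalForm`), explicit curves on the graph show that nothing else is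
one (`IsQuadraticFrame.secondFundamentalForm_unique`), and nondegeneracy makes it surjective. Finally
a surjective `σ` is determined up to isomorphism by its system of quadrics, since the linear relations
between the vectors `σ(u, u)` are those satisfied by all quadrics of the system
(`exists_equiv_of_systemsIsomorphic`); so the system determines `Z(σ)`, and with it `X`.
-/

open LinearAlgebra.Projectivization Topology

namespace QuadSym

/-! ### Homogeneous forms and the Zariski topology -/

section Forms

variable {V V' : Type*} [AddCommGroup V] [Module ℂ V] [AddCommGroup V'] [Module ℂ V']

theorem isForm_const (c : ℂ) : IsForm 0 (fun _ : V => c) :=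
  ⟨MvPolynomial.C c, MvPolynomial.isHomogeneous_C _ _, fun v => by simp⟩

theorem isForm_linear (l : Module.Dual ℂ V) : IsForm 1 (l : V → ℂ) :=
  ⟨MvPolynomial.X l, MvPolynomial.isHomogeneous_X _ _, fun v => by simp⟩

theorem IsForm.mul {d d' : ℕ} {f g : V → ℂ} (hf : IsForm d f) (hg : IsForm d' g) :
    IsForm (d + d') (fun v => f v * g v) := by
  obtain ⟨p, hp, hpf⟩ := hf
  obtain ⟨q, hq, hqg⟩ := hg
  exact ⟨p * q, hp.mul hq, fun v => by simp [hpf, hqg]⟩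

theorem IsForm.sum {ι : Type*} {d : ℕ} (s : Finset ι) {f : ι → V → ℂ}
    (hf : ∀ i ∈ s, IsForm d (f i)) : IsForm d (fun v => ∑ i ∈ s, f i v) := by
  choose! p hp hpf using hf
  refine ⟨∑ i ∈ s, p i, MvPolynomial.IsHomogeneous.sum _ _ _ hp, fun v => ?_⟩
  rw [map_sum]
  exact Finset.sum_congr rfl fun i hi => hpf i hi v

theorem IsForm.comp_linearMap {d : ℕ} {f : V' → ℂ} (hf : IsForm d f) (g : V →ₗ[ℂ] V') :
    IsForm d (fun v => f (g v)) := by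
  obtain ⟨p, hp, hpf⟩ := hf
  refine ⟨MvPolynomial.rename (fun l => l ∘ₗ g) p, hp.rename_isHomogeneous, fun v => ?_⟩
  simp only [hpf, MvPolynomial.eval_rename]
  rfl

theorem IsForm.map_smul {d : ℕ} {f : V → ℂ} (hf : IsForm d f) (c : ℂ) (v : V) :
    f (c • v) = c ^ d * f v := by
  obtain ⟨p, hp, hpf⟩ := hf
  rw [hpf, hpf, MvPolynomial.eval_eq, MvPolynomial.eval_eq, Finset.mul_sum]
  refine Finset.sum_congr rfl fun m hm => ?_
  have hd : ∑ i ∈ m.support, m i = d := by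
    have := hp (MvPolynomial.mem_support_iff.mp hm)
    rwa [Finsupp.weight_apply, Finsupp.sum, Finset.sum_congr rfl (g := fun i => m i)] at this
    intro i _
    simp
  simp only [_root_.map_smul, smul_eq_mul, mul_pow, Finset.prod_mul_distrib]
  rw [Finset.prod_pow_eq_pow_sum, hd]
  ring

/-- A quadratic expression `b(u, u)` in a bilinear form `b` on a finite dimensional space is a form
of degree two. -/
theorem isForm_bilin [FiniteDimensional ℂ V] (b : V →ₗ[ℂ] V →ₗ[ℂ] ℂ) :
    IsForm 2 (fun v => b v v) := by
  let β := Module.finBasis ℂ V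
  have h : (fun v => b v v) = fun v => ∑ i, β.coord i v * b (β i) v := by
    funext v
    have : b (∑ i, β.repr v i • β i) v = b v v := by rw [β.sum_repr]
    rw [← this, map_sum, LinearMap.sum_apply]
    simp
  rw [h]
  exact IsForm.sum _ fun i _ => (isForm_linear (β.coord i)).mul (isForm_linear (b (β i)))

/-- A form vanishes at the point represented by `v` exactly when it vanishes at `v`. -/
theorem IsForm.vanishesAt_iff {d : ℕ} {f : V → ℂ} (hf : IsForm d f) {P : ℙ ℂ V} {v : V}
    (hv : v ∈ P.submodule) (hv0 : v ≠ 0) : VanishesAt f P ↔ f v = 0 := by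
  refine ⟨fun h => h v hv, fun h w hw => ?_⟩
  obtain ⟨c, rfl⟩ := (finrank_eq_one_iff_of_nonzero' (⟨v, hv⟩ : P.submodule)
    (by simpa [Subtype.ext_iff] using hv0)).mp P.finrank_submodule ⟨w, hw⟩ |>.imp
      fun c hc => (congrArg Subtype.val hc).symm
  simp [hf.map_smul, h]

theorem rep_mem (P : ℙ ℂ V) : P.rep ∈ P.submodule := by
  rw [P.submodule_eq]
  exact Submodule.mem_span_singleton_self _

theorem mem_submodule_mk {v : V} (hv : v ≠ 0) :
    v ∈ (Projectivization.mk ℂ v hv).submodule := by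
  rw [Projectivization.submodule_mk]
  exact Submodule.mem_span_singleton_self _

theorem eq_mk_of_mem {P : ℙ ℂ V} {v : V} (hv : v ∈ P.submodule) (hv0 : v ≠ 0) :
    P = Projectivization.mk ℂ v hv0 := by
  rw [P.submodule_eq] at hv
  obtain ⟨c, hc⟩ := Submodule.mem_span_singleton.mp hv
  conv_lhs => rw [← P.mk_rep]
  refine ((Projectivization.mk_eq_mk_iff' ℂ _ _ _ _).mpr ⟨c, hc⟩).symm

theorem mem_affineCone_iff {X : Set (ℙ ℂ V)} {P : ℙ ℂ V} {v : V} (hv : v ∈ P.submodule)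
    (hv0 : v ≠ 0) : v ∈ affineCone X ↔ P ∈ X := by
  refine ⟨?_, fun h => ⟨P, h, hv⟩⟩
  rintro ⟨Q, hQ, hvQ⟩
  rwa [eq_mk_of_mem hv hv0, ← eq_mk_of_mem hvQ hv0]

theorem smul_mem_affineCone {X : Set (ℙ ℂ V)} {v : V} (hv : v ∈ affineCone X) (c : ℂ) :
    c • v ∈ affineCone X := by
  obtain ⟨P, hP, hv⟩ := hv
  exact ⟨P, hP, P.submodule.smul_mem c hv⟩

theorem eq_zero_of_mem_affineCone {X : Set (ℙ ℂ V)} {f : V → ℂ}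
    (hf : ∀ Q ∈ X, VanishesAt f Q) {v : V} (hv : v ∈ affineCone X) : f v = 0 := by
  obtain ⟨Q, hQ, hv⟩ := hv
  exact hf Q hQ v hv

theorem IsForm.isOpen {d : ℕ} {f : V → ℂ} (hf : IsForm d f) :
    IsOpen {P : ℙ ℂ V | ¬ VanishesAt f P} :=
  TopologicalSpace.isOpen_generateFrom_of_mem ⟨d, f, hf, rfl⟩

/-- The complements of hypersurfaces are a basis of the Zariski topology, since they are stable
under finite intersections. -/
theorem exists_form_of_isOpen {O : Set (ℙ ℂ V)} (hO : IsOpen O) {P : ℙ ℂ V} (hP : P ∈ O) :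
    ∃ (d : ℕ) (f : V → ℂ), IsForm d f ∧ ¬ VanishesAt f P ∧ ∀ Q, ¬ VanishesAt f Q → Q ∈ O := by
  have key : ∀ O : Set (ℙ ℂ V), TopologicalSpace.GenerateOpen
      {O | ∃ (d : ℕ) (f : V → ℂ), IsForm d f ∧ O = {P | ¬ VanishesAt f P}} O →
      P ∈ O → ∃ (d : ℕ) (f : V → ℂ), IsForm d f ∧ ¬ VanishesAt f P ∧
        ∀ Q, ¬ VanishesAt f Q → Q ∈ O := by
    intro O h
    induction h with
    | basic s hs =>
      obtain ⟨d, f, hf, rfl⟩ := hs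
      exact fun hP => ⟨d, f, hf, hP, fun Q hQ => hQ⟩
    | univ =>
      refine fun _ => ⟨0, _, isForm_const 1, fun h => ?_, fun _ _ => trivial⟩
      exact one_ne_zero (h 0 (Submodule.zero_mem _))
    | inter s t _ _ ihs iht =>
      rintro ⟨hs, ht⟩
      obtain ⟨d, f, hf, hfP, hfs⟩ := ihs hs
      obtain ⟨d', g, hg, hgP, hgt⟩ := iht ht
      have hmul : ∀ Q, VanishesAt (fun v => f v * g v) Q ↔ VanishesAt f Q ∨ VanishesAt g Q := by
        intro Q
        rw [(hf.mul hg).vanishesAt_iff (rep_mem Q) Q.rep_nonzero,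
          hf.vanishesAt_iff (rep_mem Q) Q.rep_nonzero,
          hg.vanishesAt_iff (rep_mem Q) Q.rep_nonzero, mul_eq_zero]
      refine ⟨_, _, hf.mul hg, ?_, fun Q hQ => ?_⟩
      · rw [hmul]
        tauto
      · rw [hmul] at hQ
        push Not at hQ
        exact ⟨hfs Q hQ.1, hgt Q hQ.2⟩
    | sUnion S _ ih =>
      rintro ⟨s, hs, hPs⟩
      obtain ⟨d, f, hf, hfP, hfs⟩ := ih s hs hPs
      exact ⟨d, f, hf, hfP, fun Q hQ => ⟨s, hs, hfs Q hQ⟩⟩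
  exact key O hO hP

/-- The Zariski closure of a set is the common zero locus of the forms vanishing on it. -/
theorem mem_closure_iff_forms {S : Set (ℙ ℂ V)} {Q : ℙ ℂ V} :
    Q ∈ closure S ↔
      ∀ (d : ℕ) (f : V → ℂ), IsForm d f → (∀ R ∈ S, VanishesAt f R) → VanishesAt f Q := by
  rw [mem_closure_iff]
  constructor
  · intro h d f hf hS
    by_contra hQ
    obtain ⟨R, hR, hRS⟩ := h _ hf.isOpen hQ
    exact hR (hS R hRS)
  · intro h O hO hQ
    obtain ⟨d, f, hf, hfQ, hfO⟩ := exists_form_of_isOpen hO hQ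
    by_contra hne
    refine hfQ (h d f hf fun R hR => ?_)
    by_contra hRf
    exact hne ⟨R, hfO R hRf, hR⟩

theorem IsNondegenerateVariety.mem_iff_forms {X : Set (ℙ ℂ V)} (hX : IsNondegenerateVariety X)
    {Q : ℙ ℂ V} : Q ∈ X ↔
      ∀ (d : ℕ) (f : V → ℂ), IsForm d f → (∀ R ∈ X, VanishesAt f R) → VanishesAt f Q := by
  rw [← mem_closure_iff_forms, hX.isClosed.closure_eq]

/-- A form that vanishes on the part of an irreducible variety outside a hyperplane vanishes on the
whole variety, if the hyperplane does not contain the variety. -/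
theorem IsNondegenerateVariety.vanishesAt_of_affine {X : Set (ℙ ℂ V)}
    (hX : IsNondegenerateVariety X) {d : ℕ} {f : V → ℂ} (hf : IsForm d f) {l : Module.Dual ℂ V}
    (hl : ∃ P ∈ X, ¬ VanishesAt l P) (h : ∀ v ∈ affineCone X, l v = 1 → f v = 0) :
    ∀ Q ∈ X, VanishesAt f Q := by
  by_contra! hne
  obtain ⟨Q, hQ, hfQ⟩ := hne
  obtain ⟨P, hP, hlP⟩ := hl
  obtain ⟨R, hRX, hRf, hRl⟩ := hX.irreducible.2 _ _ hf.isOpen (isForm_linear l).isOpen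
    ⟨Q, hQ, hfQ⟩ ⟨P, hP, hlP⟩
  simp only [Set.mem_ofPred_eq] at hRf hRl
  rw [(isForm_linear l).vanishesAt_iff (rep_mem R) R.rep_nonzero] at hRl
  rw [hf.vanishesAt_iff (R.submodule.smul_mem (l R.rep)⁻¹ (rep_mem R))
    (smul_ne_zero (inv_ne_zero hRl) R.rep_nonzero)] at hRf
  refine hRf (h _ ⟨R, hRX, R.submodule.smul_mem _ (rep_mem R)⟩ ?_)
  simp [hRl]

theorem ProjectivelyEquivalent.symm {X : Set (ℙ ℂ V)} {Y : Set (ℙ ℂ V')}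
    (h : ProjectivelyEquivalent X Y) : ProjectivelyEquivalent Y X := by
  obtain ⟨g, rfl⟩ := h
  refine ⟨g.symm, ?_⟩
  rw [← Set.image_comp]
  refine (Set.image_congr fun P _ => ?_).trans (Set.image_id X)
  induction P using Projectivization.ind with
  | h v hv => simp [Projectivization.map_mk]

theorem ProjectivelyEquivalent.trans {V'' : Type*} [AddCommGroup V''] [Module ℂ V'']
    {X : Set (ℙ ℂ V)} {Y : Set (ℙ ℂ V')} {Z : Set (ℙ ℂ V'')}
    (h : ProjectivelyEquivalent X Y) (h' : ProjectivelyEquivalent Y Z) :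
    ProjectivelyEquivalent X Z := by
  obtain ⟨g, rfl⟩ := h
  obtain ⟨g', rfl⟩ := h'
  refine ⟨g.trans g', ?_⟩
  rw [← Set.image_comp]
  congr 1
  funext P
  induction P using Projectivization.ind with
  | h v hv => simp [Projectivization.map_mk]

end Forms

/-! ### Differentials of forms and the affine tangent space -/

section Smooth

variable {V : Type*} [NormedAddCommGroup V] [NormedSpace ℂ V]

theorem fderiv_eq_zero_of_mem_affineTangent {X : Set (ℙ ℂ V)} {P : ℙ ℂ V} {v a : V}
    (hv : v ∈ P.submodule) (ha : a ∈ affineTangent X P) {d : ℕ} {f : V → ℂ} (hf : IsForm d f)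
    (hX : ∀ Q ∈ X, VanishesAt f Q) : fderiv ℂ f v a = 0 := by
  simp only [affineTangent, Submodule.mem_iInf, LinearMap.mem_ker, ContinuousLinearMap.coe_coe]
    at ha
  exact ha f ⟨⟨d, hf⟩, hX⟩ v hv

variable [FiniteDimensional ℂ V]

theorem IsForm.contDiff {d : ℕ} {f : V → ℂ} (hf : IsForm d f) {n : WithTop ℕ∞} :
    ContDiff ℂ n f := by
  obtain ⟨p, -, hpf⟩ := hf
  obtain rfl : f = _ := funext hpf
  induction p using MvPolynomial.induction_on with
  | C a => simpa using contDiff_const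
  | add p q hp hq => simpa using (hp fun _ => rfl).add (hq fun _ => rfl)
  | mul_X p l hp =>
    simpa using (hp fun _ => rfl).mul (LinearMap.toContinuousLinearMap l).contDiff

theorem IsForm.differentiable {d : ℕ} {f : V → ℂ} (hf : IsForm d f) : Differentiable ℂ f :=
  (hf.contDiff (n := 1)).differentiable (by simp)

theorem IsForm.continuous_fderiv {d : ℕ} {f : V → ℂ} (hf : IsForm d f) :
    Continuous (fderiv ℂ f) :=
  (hf.contDiff (n := 1)).continuous_fderiv (by simp)

theorem eq_zero_of_continuous {g : ℂ → ℂ} (hg : Continuous g) (h : ∀ c, c ≠ 0 → g c = 0) (c : ℂ) :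
    g c = 0 :=
  congrFun (hg.ext_on (dense_compl_singleton 0) continuous_const fun c hc => h c hc) c

/-- The kernel of the differential of a form at a nonzero point `v` is contained in the kernel of
the differential at every point of the line through `v`. At the origin this is a limit. -/
theorem IsForm.fderiv_smul_eq_zero {d : ℕ} {f : V → ℂ} (hf : IsForm d f) {v a : V}
    (h : fderiv ℂ f v a = 0) (c : ℂ) : fderiv ℂ f (c • v) a = 0 := by
  have hne : ∀ c : ℂ, c ≠ 0 → fderiv ℂ f (c • v) a = 0 := by
    intro c hc
    have h1 : HasFDerivAt (fun x => f (c • x))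
        ((fderiv ℂ f (c • v)).comp (c • ContinuousLinearMap.id ℂ V)) v :=
      (hf.differentiable _).hasFDerivAt.comp v ((hasFDerivAt_id v).const_smul c)
    have h2 : HasFDerivAt (fun x => f (c • x)) (c ^ d • fderiv ℂ f v) v := by
      simp only [hf.map_smul]
      exact (hf.differentiable v).hasFDerivAt.const_mul _
    have := congrArg (fun L => L a) (h1.unique h2)
    simpa [h, hc] using this
  by_cases hc : c = 0
  · have hcont : Continuous fun c : ℂ => fderiv ℂ f (c • v) a :=
      (hf.continuous_fderiv.comp (continuous_id.smul continuous_const)).clm_apply continuous_const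
    exact eq_zero_of_continuous hcont hne c
  · exact hne c hc

theorem mem_affineTangent_iff {X : Set (ℙ ℂ V)} {P : ℙ ℂ V} {v a : V} (hv : v ∈ P.submodule)
    (hv0 : v ≠ 0) : a ∈ affineTangent X P ↔
      ∀ (d : ℕ) (f : V → ℂ), IsForm d f → (∀ Q ∈ X, VanishesAt f Q) → fderiv ℂ f v a = 0 := by
  constructor
  · intro h d f hf hX
    exact fderiv_eq_zero_of_mem_affineTangent hv h hf hX
  · simp only [affineTangent, Submodule.mem_iInf, LinearMap.mem_ker, ContinuousLinearMap.coe_coe]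
    rintro h f ⟨⟨d, hf⟩, hX⟩ w hw
    rw [eq_mk_of_mem hv hv0, Projectivization.submodule_mk, Submodule.mem_span_singleton] at hw
    obtain ⟨c, rfl⟩ := hw
    exact hf.fderiv_smul_eq_zero (h d f hf hX) c

end Smooth

/-! ### The affine part of the variety is the graph of a quadratic map -/

section Graph

variable {V U W : Type*} [NormedAddCommGroup V] [NormedSpace ℂ V]
  [NormedAddCommGroup U] [NormedSpace ℂ U] [NormedAddCommGroup W] [NormedSpace ℂ W]

/-- A splitting `V ≃ ℂ ⊕ U ⊕ W` in which `P̂` is the first summand, the affine tangent space is the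
sum of the first two, and the cone over `X` is stable under the `ℂ*`-action of weights `0, 1, 2`.
The tangent space is included in the data, so that this is all that is used of a quadratic
symmetry. -/
structure IsQuadraticFrame (X : Set (ℙ ℂ V)) (P : ℙ ℂ V) (e : V ≃ₗ[ℂ] ℂ × U × W) : Prop where
  mem_line : ∀ v, v ∈ P.submodule ↔ (e v).2.1 = 0 ∧ (e v).2.2 = 0
  mem_tangent : ∀ v, v ∈ affineTangent X P ↔ (e v).2.2 = 0
  stable : ∀ (c : ℂ), c ≠ 0 → ∀ (s : ℂ) (u : U) (w : W), e.symm (s, u, w) ∈ affineCone X →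
    e.symm (s, c • u, c ^ 2 • w) ∈ affineCone X

theorem IsQuadraticFrame.base_mem {X : Set (ℙ ℂ V)} {P : ℙ ℂ V} {e : V ≃ₗ[ℂ] ℂ × U × W}
    (he : IsQuadraticFrame X P e) : e.symm (1, 0, 0) ∈ P.submodule := by
  simp [he.mem_line]

theorem base_ne_zero (e : V ≃ₗ[ℂ] ℂ × U × W) (u : U) (w : W) : e.symm (1, u, w) ≠ 0 := by
  simp

theorem hasDerivAt_quadratic (p a b : V) (c : ℂ) :
    HasDerivAt (fun c : ℂ => p + c • a + c ^ 2 • b) (a + (2 * c) • b) c := by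
  have h1 := ((hasDerivAt_id c).smul_const a).const_add p
  have h2 := ((hasDerivAt_pow 2 c).smul_const b)
  simpa using h1.fun_add h2

/-- If a function vanishes along `c ↦ p + c a + c² b`, the coefficient of `c²` in its expansion
vanishes. -/
theorem fderiv_add_sndFDeriv_eq_zero {f : V → ℂ} (hf : ContDiff ℂ 2 f) {p a b : V}
    (h : ∀ c : ℂ, f (p + c • a + c ^ 2 • b) = 0) :
    2 * fderiv ℂ f p b + fderiv ℂ (fderiv ℂ f) p a a = 0 := by
  have hγ := hasDerivAt_quadratic p a b
  have hd : Differentiable ℂ f := hf.differentiable (by simp)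
  have hd' : Differentiable ℂ (fderiv ℂ f) :=
    (hf.fderiv_right (m := 1) (by norm_num)).differentiable (by simp)
  have h1 : ∀ c : ℂ, fderiv ℂ f (p + c • a + c ^ 2 • b) (a + (2 * c) • b) = 0 := by
    intro c
    have := (hd _).hasFDerivAt.comp_hasDerivAt c (hγ c)
    have h0 : (f ∘ fun c : ℂ => p + c • a + c ^ 2 • b) = fun _ => 0 := funext h
    rw [h0] at this
    exact this.unique (hasDerivAt_const c 0)
  have hδ : HasDerivAt (fun c : ℂ => a + (2 * c) • b) ((2 : ℂ) • b) 0 := by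
    have := (((hasDerivAt_id (0 : ℂ)).const_mul 2).smul_const b).const_add a
    simpa using this
  have h2 := ((hd' _).hasFDerivAt.comp_hasDerivAt 0 (hγ 0)).clm_apply hδ
  have h0 : (fun c : ℂ => fderiv ℂ f (p + c • a + c ^ 2 • b) (a + (2 * c) • b)) = fun _ => 0 :=
    funext h1
  have h3 := h2.unique (h0 ▸ hasDerivAt_const (0 : ℂ) (0 : ℂ))
  simp at h3
  linear_combination h3

variable [FiniteDimensional ℂ V]

/-- On the affine part of the cone, the `W`-coordinate is a quadratic function of the
`U`-coordinate: the weight-two parts of the equations of `X` are of the form `x₀ ξ(w) - q(u)`, and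
the functionals `ξ` that occur span the dual of `W` because they have no common zero transversal to
the affine tangent space. -/
theorem IsQuadraticFrame.exists_bilin [FiniteDimensional ℂ W] {X : Set (ℙ ℂ V)} {P : ℙ ℂ V}
    {e : V ≃ₗ[ℂ] ℂ × U × W}
    (he : IsQuadraticFrame X P e) (hP : P ∈ X) :
    ∃ B : U →ₗ[ℂ] U →ₗ[ℂ] W, (∀ u u', B u u' = B u' u) ∧
      ∀ u w, e.symm (1, u, w) ∈ affineCone X → w = B u u := by
  set p := e.symm (1, 0, 0) with hp
  let jU : U →ₗ[ℂ] V := (e.symm : _ →ₗ[ℂ] V) ∘ₗ LinearMap.inr ℂ ℂ (U × W) ∘ₗ LinearMap.inl ℂ U W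
  let jW : W →ₗ[ℂ] V := (e.symm : _ →ₗ[ℂ] V) ∘ₗ LinearMap.inr ℂ ℂ (U × W) ∘ₗ LinearMap.inr ℂ U W
  have hj : ∀ u w, e.symm (1, u, w) = p + jU u + jW w := by
    intro u w
    simp [hp, jU, jW, ← map_add]
  let D : Set (Module.Dual ℂ W) := {ξ | ∃ (d : ℕ) (f : V → ℂ), IsForm d f ∧
    (∀ Q ∈ X, VanishesAt f Q) ∧ ξ = (fderiv ℂ f p : V →ₗ[ℂ] ℂ) ∘ₗ jW}
  have hspan : Submodule.span ℂ D = ⊤ := by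
    rw [← Subspace.dualCoannihilator_dualAnnihilator_eq (W := Submodule.span ℂ D),
      ← Submodule.dualAnnihilator_bot]
    congr 1
    rw [eq_bot_iff]
    intro w hw
    rw [Submodule.mem_dualCoannihilator] at hw
    have : jW w ∈ affineTangent X P := by
      rw [mem_affineTangent_iff he.base_mem (base_ne_zero e 0 0)]
      intro d f hf hX
      exact hw _ (Submodule.subset_span ⟨d, f, hf, hX, rfl⟩)
    simpa [he.mem_tangent, jW] using this
  have hquad : ∀ ξ : Module.Dual ℂ W, ∃ b : U →ₗ[ℂ] U →ₗ[ℂ] ℂ,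
      ∀ u w, e.symm (1, u, w) ∈ affineCone X → ξ w = b u u := by
    intro ξ
    have hξ : ξ ∈ Submodule.span ℂ D := hspan ▸ Submodule.mem_top
    induction hξ using Submodule.span_induction with
    | mem ξ h =>
      obtain ⟨d, f, hf, hX, rfl⟩ := h
      refine ⟨LinearMap.mk₂ ℂ
        (fun u u' => -(1 / 2) * fderiv ℂ (fderiv ℂ f) p (jU u) (jU u')) ?_ ?_ ?_ ?_, ?_⟩
      · intros; simp; ring
      · intros; simp; ring
      · intros; simp; ring
      · intros; simp; ring
      intro u w huw
      have := fderiv_add_sndFDeriv_eq_zero (f := f) (p := p) (a := jU u) (b := jW w) hf.contDiff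
        (fun c => ?_)
      · simp only [LinearMap.mk₂_apply, LinearMap.comp_apply, ContinuousLinearMap.coe_coe]
        linear_combination (1 / 2) * this
      · rw [← map_smul, ← map_smul, ← hj]
        refine eq_zero_of_mem_affineCone hX ?_
        by_cases hc : c = 0
        · subst hc
          simpa using ⟨P, hP, he.base_mem⟩
        · exact he.stable c hc _ _ _ huw
    | zero => exact ⟨0, fun _ _ _ => rfl⟩
    | add ξ η _ _ hξ hη =>
      obtain ⟨b, hb⟩ := hξ
      obtain ⟨b', hb'⟩ := hη
      exact ⟨b + b', fun u w h => by simp [hb u w h, hb' u w h]⟩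
    | smul c ξ _ hξ =>
      obtain ⟨b, hb⟩ := hξ
      exact ⟨c • b, fun u w h => by simp [hb u w h]⟩
  choose b hb using hquad
  let β := Module.finBasis ℂ W
  let B₀ : U →ₗ[ℂ] U →ₗ[ℂ] W :=
    ∑ k, (b (β.coord k)).compr₂ (LinearMap.toSpanSingleton ℂ W (β k))
  -- symmetrizing does not change the values on the diagonal
  refine ⟨(1 / 2 : ℂ) • (B₀ + B₀.flip), fun u u' => ?_, fun u w h => ?_⟩
  · simp [add_comm]
  · have h1 : w = B₀ u u := by
      conv_lhs => rw [← β.sum_repr w]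
      simp [B₀, LinearMap.sum_apply, ← hb _ u w h]
    have h2 : ((1 / 2 : ℂ) • (B₀ + B₀.flip)) u u = B₀ u u := by
      simp [← two_smul ℂ]
    rw [h2, ← h1]

/-- Near `P`, the variety contains a point over every small `u : U`: the local equations given by
nonsingularity, together with the coordinates `x₀` and `u`, form a submersion at `P`. -/
theorem IsQuadraticFrame.eventually_exists_mem [FiniteDimensional ℂ U]
    [FiniteDimensional ℂ W] {X : Set (ℙ ℂ V)} {P : ℙ ℂ V}
    {e : V ≃ₗ[ℂ] ℂ × U × W} (he : IsQuadraticFrame X P e) (hP : IsNonsingularPoint X P) :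
    ∀ᶠ u in 𝓝 (0 : U), ∃ w, e.symm (1, u, w) ∈ affineCone X := by
  obtain ⟨hPX, k, f, O, hf, hli, hO, hPO, hcut⟩ := hP
  obtain ⟨d, g, hg, hgP, hgO⟩ := exists_form_of_isOpen hO hPO
  set p := e.symm (1, 0, 0) with hp
  have hpP : p ∈ P.submodule := he.base_mem
  have hp0 : p ≠ 0 := base_ne_zero e 0 0
  have hgp : g p ≠ 0 := fun h => hgP ((hg.vanishesAt_iff hpP hp0).mpr h)
  have hfp : ∀ i, f i p = 0 := fun i => (hf i).2 P hPX p hpP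
  choose df hdf using fun i => (hf i).1
  let F : V → Fin k → ℂ := fun v i => f i v
  let π : V →L[ℂ] ℂ × U := LinearMap.toContinuousLinearMap
    ((LinearMap.fst ℂ ℂ (U × W) ∘ₗ (e : V →ₗ[ℂ] _)).prod
      (LinearMap.fst ℂ U W ∘ₗ LinearMap.snd ℂ ℂ (U × W) ∘ₗ (e : V →ₗ[ℂ] _)))
  have hπ : ∀ v, π v = ((e v).1, (e v).2.1) := fun v => rfl
  let F' : V →L[ℂ] Fin k → ℂ := ContinuousLinearMap.pi fun i => fderiv ℂ (f i) p
  have hF : HasStrictFDerivAt F F' p := by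
    rw [hasStrictFDerivAt_pi]
    exact fun i => (((hdf i).contDiff (n := 1)).contDiffAt).hasStrictFDerivAt (by simp)
  have hΦ := hF.prodMk π.hasStrictFDerivAt
  have hF'T : ∀ v ∈ affineTangent X P, F' v = 0 := by
    intro v hv
    funext i
    exact (mem_affineTangent_iff hpP hp0).mp hv _ _ (hdf i) (hf i).2
  have hF'surj : Function.Surjective F' := by
    have h1 := hli p hpP hp0
    change Function.Surjective (F' : V →ₗ[ℂ] Fin k → ℂ)
    rw [← LinearMap.range_eq_top]
    by_contra hne
    obtain ⟨l, hl0, hl⟩ := Submodule.exists_le_ker_of_lt_top _ (lt_top_iff_ne_top.mpr hne)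
    refine hl0 ?_
    rw [Fintype.linearIndependent_iff] at h1
    have h2 := h1 (fun i => l (Pi.single i 1)) ?_
    · ext i
      simpa using h2 i
    · ext v
      have h3 : l (F' v) = 0 := hl ⟨v, rfl⟩
      rw [← Finset.univ_sum_single (F' v), map_sum] at h3
      refine Eq.trans ?_ h3
      rw [sum_apply]
      refine Finset.sum_congr rfl fun i _ => ?_
      have h4 : Pi.single i (F' v i) = F' v i • (Pi.single i 1 : Fin k → ℂ) := by
        rw [← Pi.single_smul, smul_eq_mul, mul_one]
      rw [h4, map_smul]
      simp [F', mul_comm]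
  have hsurj : (F'.prod π).range = ⊤ := by
    rw [LinearMap.range_eq_top]
    rintro ⟨y, s, u⟩
    obtain ⟨v, hv⟩ := hF'surj y
    -- replacing the tangential coordinates of `v` does not change `F' v`
    refine ⟨e.symm (s, u, (e v).2.2), ?_⟩
    have h1 : e.symm (s, u, (e v).2.2) = v + e.symm (s - (e v).1, u - (e v).2.1, 0) := by
      apply e.injective
      ext <;> simp
    have h2 : F' (e.symm (s, u, (e v).2.2)) = y := by
      rw [h1, map_add, hv, hF'T, add_zero]
      simp [he.mem_tangent]
    simp [h2, hπ]
  have hmap := hΦ.map_nhds_eq_of_surj hsurj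
  have hgnhds : ∀ᶠ v in 𝓝 p, g v ≠ 0 :=
    hg.differentiable.continuous.continuousAt.eventually_ne hgp
  have himg : (fun v => (F v, π v)) '' {v | g v ≠ 0} ∈ 𝓝 ((F p, π p)) := by
    rw [← hmap]
    exact Filter.image_mem_map hgnhds
  have hFp : (F p, π p) = (0, 1, 0) := by
    simp [hπ, hp]
    exact funext hfp
  rw [hFp] at himg
  have hcont : Filter.Tendsto (fun u : U => ((0 : Fin k → ℂ), (1 : ℂ), u)) (𝓝 0)
      (𝓝 ((0 : Fin k → ℂ), (1 : ℂ), (0 : U))) :=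
    (Continuous.tendsto (by fun_prop) 0)
  filter_upwards [hcont himg] with u hu
  obtain ⟨v, hgv, hv⟩ := hu
  simp only [hπ, Prod.mk.injEq] at hv
  obtain ⟨hv1, hv2, hv3⟩ := hv
  have hv' : e.symm (1, u, (e v).2.2) = v := by
    rw [← hv2, ← hv3]
    simp
  have hv0 : v ≠ 0 := hv' ▸ base_ne_zero e u _
  refine ⟨(e v).2.2, ?_⟩
  rw [hv']
  refine (mem_affineCone_iff (mem_submodule_mk hv0) hv0).mpr (hcut _ (hgO _ ?_) fun i => ?_)
  · rwa [hg.vanishesAt_iff (mem_submodule_mk hv0) hv0]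
  · rw [(hdf i).vanishesAt_iff (mem_submodule_mk hv0) hv0]
    exact congrFun hv1 i

/-- In a quadratic frame, the affine part `x₀ = 1` of the variety is the graph of a quadratic
map. -/
theorem IsQuadraticFrame.exists_graph [FiniteDimensional ℂ U]
    [FiniteDimensional ℂ W] {X : Set (ℙ ℂ V)} {P : ℙ ℂ V} {e : V ≃ₗ[ℂ] ℂ × U × W}
    (he : IsQuadraticFrame X P e) (hP : IsNonsingularPoint X P) :
    ∃ B : U →ₗ[ℂ] U →ₗ[ℂ] W, (∀ u u', B u u' = B u' u) ∧
      ∀ u w, e.symm (1, u, w) ∈ affineCone X ↔ w = B u u := by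
  obtain ⟨B, hsymm, hB⟩ := he.exists_bilin hP.1
  refine ⟨B, hsymm, fun u w => ⟨hB u w, ?_⟩⟩
  rintro rfl
  have hlim : Filter.Tendsto (fun c : ℂ => c • u) (𝓝[≠] 0) (𝓝 0) := by
    refine tendsto_nhdsWithin_of_tendsto_nhds ?_
    have : Continuous fun c : ℂ => c • u := by fun_prop
    simpa using this.tendsto 0
  obtain ⟨c, ⟨w, hw⟩, hc⟩ :=
    ((hlim.eventually (he.eventually_exists_mem hP)).and self_mem_nhdsWithin).exists
  have hc0 : c ≠ 0 := hc
  have h := he.stable c⁻¹ (inv_ne_zero hc0) _ _ _ hw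
  rw [hB _ _ hw] at h
  have h2 : c⁻¹ ^ 2 • (B (c • u)) (c • u) = B u u := by
    simp only [map_smul, LinearMap.smul_apply, smul_smul]
    field_simp
    simp
  rwa [h2, smul_smul, inv_mul_cancel₀ hc0, one_smul] at h

end Graph

/-! ### The second fundamental form -/

section SecondFundamentalForm

/-- If `L` is a line with coordinate `ε`, then `Hom(L, M / K)` is identified with `U` by any
surjection `φ : M → U` with kernel `K`. -/
theorem exists_homLineEquiv {L M U : Type*} [AddCommGroup L] [Module ℂ L] [AddCommGroup M]
    [Module ℂ M] [AddCommGroup U] [Module ℂ U] (ε : L ≃ₗ[ℂ] ℂ) (φ : M →ₗ[ℂ] U)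
    (hφ : Function.Surjective φ) {K : Submodule ℂ M} (hK : LinearMap.ker φ = K) :
    ∃ τ : (L →ₗ[ℂ] M ⧸ K) ≃ₗ[ℂ] U, ∀ (a : L →ₗ[ℂ] M ⧸ K) (p : L) (v : M),
      a p = Submodule.Quotient.mk v → φ v = ε p • τ a := by
  subst hK
  refine ⟨(ε.arrowCongr (φ.quotKerEquivOfSurjective hφ)).trans
    (LinearMap.ringLmapEquivSelf ℂ ℂ U), fun a p v h => ?_⟩
  have h1 : p = ε p • ε.symm 1 := by
    apply ε.injective
    simp
  have h2 : φ.quotKerEquivOfSurjective hφ (a p) = φ v := by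
    rw [h]
    rfl
  rw [← h2]
  conv_lhs => rw [h1, map_smul, map_smul]
  rfl

variable {V U W : Type*} [NormedAddCommGroup V] [NormedSpace ℂ V]
  [NormedAddCommGroup U] [NormedSpace ℂ U] [NormedAddCommGroup W] [NormedSpace ℂ W]

theorem IsQuadraticFrame.exists_lineEquiv {X : Set (ℙ ℂ V)} {P : ℙ ℂ V}
    {e : V ≃ₗ[ℂ] ℂ × U × W} (he : IsQuadraticFrame X P e) :
    ∃ ε : P.submodule ≃ₗ[ℂ] ℂ, ∀ p : P.submodule, ε p = (e (p : V)).1 := by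
  refine ⟨LinearEquiv.ofBijective
    (LinearMap.fst ℂ ℂ (U × W) ∘ₗ (e : V →ₗ[ℂ] _) ∘ₗ P.submodule.subtype) ⟨?_, fun s => ?_⟩,
    fun p => rfl⟩
  · rw [injective_iff_map_eq_zero]
    rintro ⟨v, hv⟩ h
    have h' : (e v).1 = 0 := h
    have hv' := (he.mem_line v).mp hv
    have : e v = 0 := Prod.ext h' (Prod.ext hv'.1 hv'.2)
    simpa using this
  · exact ⟨⟨e.symm (s, 0, 0), by simp [he.mem_line]⟩, by simp⟩

/-- The identification of `T_P X` with `U` by the differentials of the coordinates `u / x₀`. -/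
theorem IsQuadraticFrame.exists_tangentEquiv {X : Set (ℙ ℂ V)} {P : ℙ ℂ V}
    {e : V ≃ₗ[ℂ] ℂ × U × W} (he : IsQuadraticFrame X P e) :
    ∃ τ : TangentSpaceAt X P ≃ₗ[ℂ] U, ∀ (a : TangentSpaceAt X P) (p : P.submodule)
      (u : affineTangent X P), a p = Submodule.Quotient.mk u →
        (e (u : V)).2.1 = (e (p : V)).1 • τ a := by
  obtain ⟨ε, hε⟩ := he.exists_lineEquiv
  obtain ⟨τ, hτ⟩ := exists_homLineEquiv (K := P.submodule.submoduleOf (affineTangent X P)) ε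
    (LinearMap.fst ℂ U W ∘ₗ LinearMap.snd ℂ ℂ (U × W) ∘ₗ (e : V →ₗ[ℂ] _) ∘ₗ
      (affineTangent X P).subtype)
    (fun u => ⟨⟨e.symm (0, u, 0), by simp [he.mem_tangent]⟩, by simp⟩) (by
      ext ⟨v, hv⟩
      simp [Submodule.submoduleOf, he.mem_line, (he.mem_tangent v).mp hv])
  exact ⟨τ, fun a p u h => by simpa [hε] using hτ a p u h⟩

/-- The identification of the normal space with `W` by the differentials of the coordinates
`w / x₀`. -/
theorem IsQuadraticFrame.exists_normalEquiv {X : Set (ℙ ℂ V)} {P : ℙ ℂ V}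
    {e : V ≃ₗ[ℂ] ℂ × U × W} (he : IsQuadraticFrame X P e) :
    ∃ β : NormalSpaceAt X P ≃ₗ[ℂ] W, ∀ (b : NormalSpaceAt X P) (p : P.submodule)
      (v : V), b p = Submodule.Quotient.mk v → (e v).2.2 = (e (p : V)).1 • β b := by
  obtain ⟨ε, hε⟩ := he.exists_lineEquiv
  obtain ⟨β, hβ⟩ := exists_homLineEquiv (K := affineTangent X P) ε
    (LinearMap.snd ℂ U W ∘ₗ LinearMap.snd ℂ ℂ (U × W) ∘ₗ (e : V →ₗ[ℂ] _))
    (fun w => ⟨e.symm (0, 0, w), by simp⟩) (by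
      ext v
      simp [he.mem_tangent])
  exact ⟨β, fun b p v h => by simpa [hε] using hβ b p v h⟩

/-- The affine part `x₀ = 1` of `X` in the splitting `e` is the graph of `u ↦ B(u, u)` with `B`
symmetric. As `X` is irreducible, it is then the closure of this part. -/
structure IsQuadraticGraph (X : Set (ℙ ℂ V)) (e : V ≃ₗ[ℂ] ℂ × U × W)
    (B : U →ₗ[ℂ] U →ₗ[ℂ] W) : Prop where
  variety : IsNondegenerateVariety X
  symm : ∀ u u', B u u' = B u' u
  mem_iff : ∀ u w, e.symm (1, u, w) ∈ affineCone X ↔ w = B u u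

variable {X : Set (ℙ ℂ V)} {P : ℙ ℂ V} {e : V ≃ₗ[ℂ] ℂ × U × W} {B : U →ₗ[ℂ] U →ₗ[ℂ] W}

/-- A form vanishes on `X` as soon as it vanishes on the affine graph. -/
theorem IsQuadraticGraph.vanishesAt_of_graph (hB : IsQuadraticGraph X e B) {d : ℕ} {f : V → ℂ}
    (hf : IsForm d f) (h : ∀ u, f (e.symm (1, u, B u u)) = 0) : ∀ Q ∈ X, VanishesAt f Q := by
  have h0 := (hB.mem_iff 0 (B 0 0)).mpr rfl
  obtain ⟨P, hP, hp⟩ := h0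
  refine hB.variety.vanishesAt_of_affine hf
    (l := LinearMap.fst ℂ ℂ (U × W) ∘ₗ (e : V →ₗ[ℂ] _)) ⟨P, hP, fun h => ?_⟩ fun v hv hv1 => ?_
  · simpa using h _ hp
  · have hv' : v = e.symm (1, (e v).2.1, (e v).2.2) := by
      apply e.injective
      simpa [Prod.ext_iff] using hv1
    rw [hv'] at hv ⊢
    rw [(hB.mem_iff _ _).mp hv]
    exact h _

/-- By nondegeneracy, the values `B(u, u)` span `W`. -/
theorem IsQuadraticGraph.dual_eq_zero (hB : IsQuadraticGraph X e B) {ξ : Module.Dual ℂ W}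
    (h : ∀ u, ξ (B u u) = 0) : ξ = 0 := by
  have h0 := hB.variety.nondegenerate
    (ξ ∘ₗ LinearMap.snd ℂ U W ∘ₗ LinearMap.snd ℂ ℂ (U × W) ∘ₗ (e : V →ₗ[ℂ] _))
    (hB.vanishesAt_of_graph (isForm_linear _) fun u => by simp [h])
  ext w
  simpa using congrArg (fun l => l (e.symm (0, 0, w))) h0

/-- A bilinear form, not symmetric, whose diagonal is the quadratic equation `x₀ ξ(w) - ξ(B(u, u))`
of `X`, where `ξ` is a linear functional on `W`. -/
noncomputable def graphEquation (e : V ≃ₗ[ℂ] ℂ × U × W) (B : U →ₗ[ℂ] U →ₗ[ℂ] W)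
    (ξ : Module.Dual ℂ W) : V →ₗ[ℂ] V →ₗ[ℂ] ℂ :=
  LinearMap.mk₂ ℂ (fun v v' => (e v).1 * ξ (e v').2.2 - ξ (B (e v).2.1 (e v').2.1))
    (by intros; simp; ring) (by intros; simp; ring) (by intros; simp; ring) (by intros; simp; ring)

theorem graphEquation_apply (ξ : Module.Dual ℂ W) (v v' : V) : graphEquation e B ξ v v' =
    (e v).1 * ξ (e v').2.2 - ξ (B (e v).2.1 (e v').2.1) := rfl

variable [FiniteDimensional ℂ V]

theorem hasDerivAt_bilin (b : V →ₗ[ℂ] V →ₗ[ℂ] ℂ) {y w : ℂ → V} {y' w' : V} {t : ℂ}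
    (hy : HasDerivAt y y' t) (hw : HasDerivAt w w' t) :
    HasDerivAt (fun s => b (y s) (w s)) (b y' (w t) + b (y t) w') t := by
  let b' : V →L[ℂ] V →L[ℂ] ℂ := LinearMap.toContinuousLinearMap
    ((LinearMap.toContinuousLinearMap : (V →ₗ[ℂ] ℂ) ≃ₗ[ℂ] V →L[ℂ] ℂ).toLinearMap ∘ₗ b)
  exact (b'.hasFDerivAt.comp_hasDerivAt t hy).clm_apply hw

theorem fderiv_bilin (b : V →ₗ[ℂ] V →ₗ[ℂ] ℂ) (y w : V) :
    fderiv ℂ (fun v => b v v) y w = b y w + b w y := by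
  have hc := hasDerivAt_quadratic y w 0 0
  have h1 := hasDerivAt_bilin b hc hc
  have h2 := ((isForm_bilin b).differentiable _).hasFDerivAt.comp_hasDerivAt (0 : ℂ) hc
  simpa [add_comm] using h2.unique h1

/-- Differentiating the equations `x₀ ξ(w) = ξ(B(u, u))` shows that `2 B` is the second fundamental
form. -/
theorem IsQuadraticFrame.isSecondFundamentalForm (he : IsQuadraticFrame X P e)
    (hB : IsQuadraticGraph X e B) {τ : TangentSpaceAt X P ≃ₗ[ℂ] U}
    (hτ : ∀ (a : TangentSpaceAt X P) (p : P.submodule) (u : affineTangent X P),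
      a p = Submodule.Quotient.mk u → (e (u : V)).2.1 = (e (p : V)).1 • τ a)
    {β : NormalSpaceAt X P ≃ₗ[ℂ] W}
    (hβ : ∀ (b : NormalSpaceAt X P) (p : P.submodule) (v : V),
      b p = Submodule.Quotient.mk v → (e v).2.2 = (e (p : V)).1 • β b)
    {σ : TangentSpaceAt X P →ₗ[ℂ] TangentSpaceAt X P →ₗ[ℂ] NormalSpaceAt X P}
    (hσ : ∀ a b, β (σ a b) = (2 : ℂ) • B (τ a) (τ b)) : IsSecondFundamentalForm X P σ := by
  intro a b p u w₀ y w hp hy hw hyw hy0 hy' hw0 hau hbw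
  obtain ⟨v, hv⟩ := Submodule.Quotient.mk_surjective _ (σ a b p)
  rw [← hv, Submodule.Quotient.eq, he.mem_tangent, map_sub, Prod.snd_sub, Prod.snd_sub, sub_eq_zero]
  -- at `t = 0` only `x₀` of `y` and the tangential coordinates of `y'` and `w` can be nonzero
  have hpe := (he.mem_line p).mp p.2
  have hp1 : (e (p : V)).1 ≠ 0 := by
    intro h
    have h0 : e (p : V) = 0 := Prod.ext h (Prod.ext hpe.1 hpe.2)
    exact hp (Subtype.ext (by simpa using h0))
  have huW := (he.mem_tangent u).mp u.2
  have hwW := (he.mem_tangent w₀).mp w₀.2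
  rw [hβ _ p v hv.symm, hσ, ← sub_eq_zero, ← Module.forall_dual_apply_eq_zero_iff ℂ]
  intro ξ
  set b' := graphEquation e B ξ with hb'
  have hX : ∀ Q ∈ X, VanishesAt (fun v => b' v v) Q :=
    hB.vanishesAt_of_graph (isForm_bilin b') fun u => by simp [hb', graphEquation_apply]
  have hzero : (fun t => b' (y t) (w t) + b' (w t) (y t)) =ᶠ[𝓝 0] fun _ => 0 := by
    filter_upwards [hyw] with t ht
    obtain ⟨Q, -, hyQ, hwQ⟩ := ht
    rw [← fderiv_bilin]
    exact fderiv_eq_zero_of_mem_affineTangent hyQ hwQ (isForm_bilin b') hX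
  have hyd := hy.differentiableAt.hasDerivAt
  have hwd := hw.differentiableAt.hasDerivAt
  have h := ((hasDerivAt_bilin b' hyd hwd).fun_add (hasDerivAt_bilin b' hwd hyd)).unique
    ((hasDerivAt_const (0 : ℂ) (0 : ℂ)).congr_of_eventuallyEq hzero)
  rw [hy0, hy', hw0] at h
  simp only [hb', graphEquation_apply, hpe.1, hpe.2, huW, hwW, hτ a p u hau, hτ b p w₀ hbw,
    hB.symm (τ b) (τ a), map_zero, map_smul, LinearMap.smul_apply, smul_eq_mul,
    LinearMap.zero_apply] at h
  simp only [map_sub, map_smul, smul_eq_mul]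
  apply mul_left_cancel₀ hp1
  linear_combination -h

/-- The vectors `(0, u', 2 B(u, u'))` are tangent to the cone at `(1, u, B(u, u))`. -/
theorem IsQuadraticGraph.mem_affineTangent (hB : IsQuadraticGraph X e B) {Q : ℙ ℂ V} {u : U}
    (hQ : e.symm (1, u, B u u) ∈ Q.submodule) (u' : U) :
    e.symm (0, u', (2 : ℂ) • B u u') ∈ affineTangent X Q := by
  rw [mem_affineTangent_iff hQ (base_ne_zero e _ _)]
  intro d f hf hX
  have h1 := (hf.differentiable _).hasFDerivAt.comp_hasDerivAt (0 : ℂ)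
    (hasDerivAt_quadratic (e.symm (1, u, B u u)) (e.symm (0, u', (2 : ℂ) • B u u'))
      (e.symm (0, 0, B u' u')) 0)
  have h2 : (f ∘ fun c : ℂ => e.symm (1, u, B u u) + c • e.symm (0, u', (2 : ℂ) • B u u') +
      c ^ 2 • e.symm (0, 0, B u' u')) = fun _ => 0 := by
    funext c
    refine eq_zero_of_mem_affineCone hX ?_
    simp only [← map_smul, ← map_add]
    have := (hB.mem_iff (u + c • u') _).mpr rfl
    convert this using 2
    simp [hB.symm u' u, smul_smul, pow_two, two_smul, add_assoc]
  rw [h2] at h1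
  simpa using h1.unique (hasDerivAt_const _ _)

/-- The curves `t ↦ (1, t u, t² B(u, u))` exhaust the tangent directions at `P`, and so determine
the second fundamental form. -/
theorem IsQuadraticFrame.secondFundamentalForm_unique (he : IsQuadraticFrame X P e)
    (hB : IsQuadraticGraph X e B)
    {σ σ' : TangentSpaceAt X P →ₗ[ℂ] TangentSpaceAt X P →ₗ[ℂ] NormalSpaceAt X P}
    (hσ : IsSecondFundamentalForm X P σ) (hσ' : IsSecondFundamentalForm X P σ') : σ = σ' := by
  obtain ⟨τ, hτ⟩ := he.exists_tangentEquiv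
  ext a b p : 3
  by_cases hp : p = 0
  · simp [hp]
  set s := (e (p : V)).1 with hs
  have hpe := (he.mem_line p).mp p.2
  have hps : (p : V) = e.symm (s, 0, 0) := by
    apply e.injective
    simp [Prod.ext_iff, hpe, hs]
  have hmk : ∀ a : TangentSpaceAt X P, a p = Submodule.Quotient.mk
      (⟨e.symm (0, s • τ a, 0), by simp [he.mem_tangent]⟩ : affineTangent X P) := by
    intro a
    obtain ⟨u, hu⟩ := Submodule.Quotient.mk_surjective _ (a p)
    rw [← hu, Submodule.Quotient.eq]
    have h1 := hτ a p u hu.symm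
    have h2 := (he.mem_tangent u).mp u.2
    simp [Submodule.submoduleOf, he.mem_line, h1, h2, hs]
  have key : ∀ σ, IsSecondFundamentalForm X P σ →
      σ a b p = Submodule.Quotient.mk (e.symm (0, 0, (2 * s) • B (τ a) (τ b))) := by
    intro σ hσ
    have hw : HasDerivAt (fun t : ℂ => e.symm (0, s • τ b, 0) +
        t • e.symm (0, 0, (2 * s) • B (τ a) (τ b)) + t ^ 2 • (0 : V))
        (e.symm (0, 0, (2 * s) • B (τ a) (τ b))) 0 := by
      simpa using hasDerivAt_quadratic (e.symm (0, s • τ b, 0))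
        (e.symm (0, 0, (2 * s) • B (τ a) (τ b))) 0 0
    have hy : HasDerivAt (fun t : ℂ => (p : V) + t • e.symm (0, s • τ a, 0) +
        t ^ 2 • e.symm (0, 0, s • B (τ a) (τ a))) (e.symm (0, s • τ a, 0)) 0 := by
      simpa using hasDerivAt_quadratic (p : V) (e.symm (0, s • τ a, 0))
        (e.symm (0, 0, s • B (τ a) (τ a))) 0
    rw [← hw.deriv]
    refine hσ a b p _ _ _ _ hp (by fun_prop) (by fun_prop) ?_ (by simp) hy.deriv (by simp)
      (hmk a) (hmk b)
    refine Filter.Eventually.of_forall fun t => ?_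
    obtain ⟨Q, hQX, hQ⟩ := (hB.mem_iff (t • τ a) _).mpr rfl
    refine ⟨Q, hQX, ?_, ?_⟩
    · convert Q.submodule.smul_mem s hQ using 1
      rw [hps]
      simp only [← map_smul, ← map_add]
      congr 1
      simp [smul_smul, pow_two, mul_comm, mul_assoc]
    · convert (affineTangent X Q).smul_mem s (hB.mem_affineTangent hQ (τ b)) using 1
      simp only [← map_smul, ← map_add, smul_zero, add_zero]
      congr 1
      simp [smul_smul, mul_comm, mul_assoc]
  rw [key σ hσ, key σ' hσ']

end SecondFundamentalForm

/-! ### Projective equivalence with the model -/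

section Model

variable {V U W : Type*} [NormedAddCommGroup V] [NormedSpace ℂ V] [FiniteDimensional ℂ V]
  [NormedAddCommGroup U] [NormedSpace ℂ U] [NormedAddCommGroup W] [NormedSpace ℂ W]
  {X : Set (ℙ ℂ V)} {P : ℙ ℂ V} {e : V ≃ₗ[ℂ] ℂ × U × W} {B : U →ₗ[ℂ] U →ₗ[ℂ] W}

/-- A form vanishing on `X` vanishes at all the vectors `(t², t u, B(u, u))`; for `t = 0` this is a
limit. -/
theorem IsQuadraticGraph.apply_eq_zero (hB : IsQuadraticGraph X e B) {d : ℕ} {f : V → ℂ}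
    (hf : IsForm d f) (hX : ∀ Q ∈ X, VanishesAt f Q) (t : ℂ) (u : U) :
    f (e.symm (t ^ 2, t • u, B u u)) = 0 := by
  have hcurve : ∀ t : ℂ, e.symm (t ^ 2, t • u, B u u) =
      e.symm (0, 0, B u u) + t • e.symm (0, u, 0) + t ^ 2 • e.symm (1, 0, 0) := by
    intro t
    simp only [← map_smul, ← map_add]
    simp
  have hcont : Continuous fun t : ℂ => f (e.symm (t ^ 2, t • u, B u u)) := by
    simp only [hcurve]
    exact hf.differentiable.continuous.comp (by fun_prop)
  refine eq_zero_of_continuous hcont (fun t ht => eq_zero_of_mem_affineCone hX ?_) t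
  convert smul_mem_affineCone ((hB.mem_iff (t⁻¹ • u) _).mpr rfl) (t ^ 2) using 1
  rw [← map_smul]
  congr 1
  have h1 : t ^ 2 * t⁻¹ = t := by
    field_simp
  have h2 : t ^ 2 * (t⁻¹ * t⁻¹) = 1 := by
    field_simp
  simp [smul_smul, h1, h2]

/-- The closure of the affine graph of `B` is projectively equivalent to `Z(σ)`, for every `σ`
obtained from `B` by linear changes of coordinates. -/
theorem IsQuadraticGraph.projectivelyEquivalent (hB : IsQuadraticGraph X e B) {U' W' : Type*}
    [AddCommGroup U'] [Module ℂ U'] [AddCommGroup W'] [Module ℂ W'] (α : U ≃ₗ[ℂ] U')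
    (β : W ≃ₗ[ℂ] W') {σ : U' →ₗ[ℂ] U' →ₗ[ℂ] W'} (hσ : ∀ u, σ (α u) (α u) = β (B u u)) :
    ProjectivelyEquivalent X (quadricImage σ) := by
  let g : V ≃ₗ[ℂ] ℂ × U' × W' := e.trans ((LinearEquiv.refl ℂ ℂ).prodCongr (α.prodCongr β))
  have hg : ∀ s u w, g (e.symm (s, u, w)) = (s, α u, β w) := fun s u w => by simp [g]
  have hgs : ∀ s u w, g.symm (s, α u, β w) = e.symm (s, u, w) := fun s u w => by
    rw [← hg, g.symm_apply_apply]
  have key : ∀ (v : V) (hv : v ≠ 0) (hgv : g v ≠ 0),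
      Projectivization.mk ℂ (g v) hgv ∈ quadricImage σ ↔ Projectivization.mk ℂ v hv ∈ X := by
    intro v hv hgv
    rw [quadricImage, mem_closure_iff_forms, hB.variety.mem_iff_forms]
    constructor
    · intro h d f hf hX
      have hf' := hf.comp_linearMap g.symm.toLinearMap
      have := h d _ hf' fun R hR => ?_
      · rw [hf'.vanishesAt_iff (mem_submodule_mk hgv) hgv] at this
        rw [hf.vanishesAt_iff (mem_submodule_mk hv) hv]
        simpa using this
      · obtain ⟨t, u, h0, hR⟩ := hR
        rw [hf'.vanishesAt_iff hR h0]
        obtain ⟨u, rfl⟩ := α.surjective u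
        rw [hσ, ← map_smul]
        simp only [LinearEquiv.coe_coe, hgs]
        exact hB.apply_eq_zero hf hX t u
    · intro h d f hf hS
      have hf' := hf.comp_linearMap g.toLinearMap
      have := h d _ hf' (hB.vanishesAt_of_graph hf' fun u => ?_)
      · rw [hf'.vanishesAt_iff (mem_submodule_mk hv) hv] at this
        rwa [hf.vanishesAt_iff (mem_submodule_mk hgv) hgv]
      · have h0 : ((1 : ℂ) ^ 2, (1 : ℂ) • α u, σ (α u) (α u)) ≠ 0 := by
          simp
        have := hS (Projectivization.mk ℂ _ h0) ⟨1, α u, h0, mem_submodule_mk h0⟩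
        rw [hf.vanishesAt_iff (mem_submodule_mk h0) h0, hσ] at this
        simpa [hg] using this
  refine ⟨g, Set.ext fun Q => ?_⟩
  induction Q using Projectivization.ind with
  | h v' hv' =>
    obtain ⟨v, rfl⟩ := g.surjective v'
    have hv : v ≠ 0 := fun h => hv' (by simp [h])
    rw [key v hv hv']
    have hmk : Projectivization.mk ℂ (g v) hv' = Projectivization.map (g : V →ₗ[ℂ] _) g.injective
      (Projectivization.mk ℂ v hv) := rfl
    rw [hmk]
    exact (Projectivization.map_injective _ g.injective).mem_set_image

end Model

/-! ### Systems of quadrics -/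

section Systems

variable {U U' W W' : Type*} [AddCommGroup U] [Module ℂ U] [AddCommGroup U'] [Module ℂ U']
  [AddCommGroup W] [Module ℂ W] [AddCommGroup W'] [Module ℂ W']

/-- The quadratic form `u ↦ ξ(σ(u, u))`. -/
noncomputable def dualQuadric (σ : U →ₗ[ℂ] U →ₗ[ℂ] W) (ξ : Module.Dual ℂ W) :
    QuadraticForm ℂ U :=
  LinearMap.BilinMap.toQuadraticMap (σ.compr₂ ξ)

theorem dualQuadric_apply (σ : U →ₗ[ℂ] U →ₗ[ℂ] W) (ξ : Module.Dual ℂ W) (u : U) :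
    dualQuadric σ ξ u = ξ (σ u u) := rfl

/-- The generators of the linear system `|σ|` already form a subspace. -/
theorem mem_quadricSystem {σ : U →ₗ[ℂ] U →ₗ[ℂ] W} {q : QuadraticForm ℂ U} :
    q ∈ quadricSystem σ ↔ ∃ ξ : Module.Dual ℂ W, ∀ u, q u = ξ (σ u u) := by
  refine ⟨fun h => ?_, fun h => Submodule.subset_span h⟩
  induction h using Submodule.span_induction with
  | mem q h => exact h
  | zero => exact ⟨0, fun u => rfl⟩
  | add q r _ _ hq hr =>
    obtain ⟨ξ, hξ⟩ := hq
    obtain ⟨η, hη⟩ := hr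
    exact ⟨ξ + η, fun u => by simp [hξ, hη]⟩
  | smul c q _ hq =>
    obtain ⟨ξ, hξ⟩ := hq
    exact ⟨c • ξ, fun u => by simp [hξ]⟩

theorem span_diag_eq_top {σ : U →ₗ[ℂ] U →ₗ[ℂ] W}
    (h : ∀ ξ : Module.Dual ℂ W, (∀ u, ξ (σ u u) = 0) → ξ = 0) :
    Submodule.span ℂ (Set.range fun u => σ u u) = ⊤ := by
  by_contra hne
  obtain ⟨ξ, hξ0, hξ⟩ := Submodule.exists_le_ker_of_lt_top _ (lt_top_iff_ne_top.mpr hne)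
  exact hξ0 (h ξ fun u => hξ (Submodule.subset_span ⟨u, rfl⟩))

theorem surjective_lift_of_dual {σ : U →ₗ[ℂ] U →ₗ[ℂ] W}
    (h : ∀ ξ : Module.Dual ℂ W, (∀ u, ξ (σ u u) = 0) → ξ = 0) :
    Function.Surjective (TensorProduct.lift σ) := by
  rw [← LinearMap.range_eq_top, eq_top_iff, ← span_diag_eq_top h, Submodule.span_le]
  rintro _ ⟨u, rfl⟩
  exact ⟨TensorProduct.tmul ℂ u u, by simp⟩

/-- An isomorphism of the systems of quadrics of two surjective forms extends to an isomorphism of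
the forms: the linear relations between the vectors `σ(u, u)` are determined by the system. -/
theorem exists_equiv_of_systemsIsomorphic {σ : U →ₗ[ℂ] U →ₗ[ℂ] W} {σ' : U' →ₗ[ℂ] U' →ₗ[ℂ] W'}
    (hσ : ∀ ξ : Module.Dual ℂ W, (∀ u, ξ (σ u u) = 0) → ξ = 0)
    (hσ' : ∀ ξ : Module.Dual ℂ W', (∀ u, ξ (σ' u u) = 0) → ξ = 0)
    (h : SystemsIsomorphic σ σ') :
    ∃ (τ : U ≃ₗ[ℂ] U') (ν : W ≃ₗ[ℂ] W'), ∀ u, σ' (τ u) (τ u) = ν (σ u u) := by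
  obtain ⟨τ, hτ⟩ := h
  let L : (U →₀ ℂ) →ₗ[ℂ] W := Finsupp.linearCombination ℂ fun u => σ u u
  let L' : (U →₀ ℂ) →ₗ[ℂ] W' := Finsupp.linearCombination ℂ fun u => σ' (τ u) (τ u)
  have hL : Function.Surjective L := by
    rw [← LinearMap.range_eq_top, Finsupp.range_linearCombination, span_diag_eq_top hσ]
  have hL' : Function.Surjective L' := by
    rw [← LinearMap.range_eq_top, Finsupp.range_linearCombination, ← span_diag_eq_top hσ']
    congr 1
    exact τ.surjective.range_comp fun u => σ' u u
  have hcomp : ∀ (ξ : Module.Dual ℂ W) (ξ' : Module.Dual ℂ W'),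
      (∀ u, ξ' (σ' (τ u) (τ u)) = ξ (σ u u)) → ∀ x, ξ' (L' x) = ξ (L x) := by
    intro ξ ξ' hξ x
    simp [L, L', Finsupp.linearCombination_apply, Finsupp.sum, hξ]
  have hker : LinearMap.ker L = LinearMap.ker L' := by
    ext x
    rw [LinearMap.mem_ker, LinearMap.mem_ker]
    constructor
    · intro hx
      rw [← Module.forall_dual_apply_eq_zero_iff ℂ]
      intro ξ'
      obtain ⟨ξ, hξ⟩ := mem_quadricSystem.mp ((hτ (dualQuadric σ' ξ')).mp
        (mem_quadricSystem.mpr ⟨ξ', fun u => rfl⟩))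
      rw [hcomp ξ ξ' hξ, hx, map_zero]
    · intro hx
      rw [← Module.forall_dual_apply_eq_zero_iff ℂ]
      intro ξ
      have hq : (dualQuadric σ ξ).comp (τ.symm : U' →ₗ[ℂ] U) ∈ quadricSystem σ' := by
        rw [hτ, mem_quadricSystem]
        exact ⟨ξ, fun u => by simp [dualQuadric_apply]⟩
      obtain ⟨ξ', hξ'⟩ := mem_quadricSystem.mp hq
      rw [← hcomp ξ ξ' fun u => ?_, hx, map_zero]
      rw [← hξ']
      simp [dualQuadric_apply]
  refine ⟨τ, (L.quotKerEquivOfSurjective hL).symm.trans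
    ((Submodule.quotEquivOfEq _ _ hker).trans (L'.quotKerEquivOfSurjective hL')), fun u => ?_⟩
  have h1 : (L.quotKerEquivOfSurjective hL).symm (σ u u) =
      Submodule.Quotient.mk (Finsupp.single u 1) := by
    rw [LinearEquiv.symm_apply_eq]
    change _ = L _
    simp [L]
  rw [LinearEquiv.trans_apply, LinearEquiv.trans_apply, h1, Submodule.quotEquivOfEq_mk]
  change _ = L' _
  simp [L']

end Systems

/-! ### Frames from quadratic symmetries -/

section Symmetry

variable {V : Type*} [NormedAddCommGroup V] [NormedSpace ℂ V]
  {X : Set (ℙ ℂ V)} {P : ℙ ℂ V} {E : ℂˣ →* (V ≃ₗ[ℂ] V)}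

/-- Bases of the weight spaces give coordinates adapted to a quadratic symmetry. -/
theorem IsQuadraticSymmetry.exists_adapted [FiniteDimensional ℂ V]
    (hE : IsQuadraticSymmetry X P E) :
    ∃ (n m : ℕ) (e : V ≃ₗ[ℂ] ℂ × (Fin n → ℂ) × (Fin m → ℂ)), AdaptedCoordinates E e := by
  obtain ⟨⟨T, N, hPT, hsup, hTN, hact⟩, -⟩ := hE
  let bT := (Module.finBasis ℂ T).equivFun.symm
  let bN := (Module.finBasis ℂ N).equivFun.symm
  let g : ℂ × (Fin _ → ℂ) × (Fin _ → ℂ) →ₗ[ℂ] V :=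
    (LinearMap.toSpanSingleton ℂ V P.rep).coprod
      ((T.subtype ∘ₗ bT.toLinearMap).coprod (N.subtype ∘ₗ bN.toLinearMap))
  have hg : ∀ s x y, g (s, x, y) = s • P.rep + (bT x + bN y) := fun s x y => by simp [g]
  have hrep := rep_mem P
  have hinj : Function.Injective g := by
    rw [injective_iff_map_eq_zero]
    rintro ⟨s, x, y⟩ h
    rw [hg] at h
    have hPx : s • P.rep + (bT x : V) ∈ affineTangent X P := by
      rw [← hsup]
      exact Submodule.add_mem_sup (P.submodule.smul_mem s hrep) (bT x).2
    have hy : (bN y : V) = 0 := by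
      refine Submodule.disjoint_def.mp hTN.disjoint _ ?_ (bN y).2
      rw [← add_assoc] at h
      rw [eq_neg_of_add_eq_zero_right h]
      exact neg_mem hPx
    rw [hy, add_zero] at h
    have hx : (bT x : V) = 0 := by
      refine Submodule.disjoint_def.mp hPT _ ?_ (bT x).2
      rw [eq_neg_of_add_eq_zero_right h]
      exact neg_mem (P.submodule.smul_mem s hrep)
    rw [hx, add_zero] at h
    have hs : s = 0 := (smul_eq_zero.mp h).resolve_right P.rep_nonzero
    have hx' : x = 0 := by simpa using hx
    have hy' : y = 0 := by simpa using hy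
    rw [hs, hx', hy']
    rfl
  have hsurj : Function.Surjective g := by
    intro v
    obtain ⟨a, ha, z, hz, rfl⟩ :=
      Submodule.mem_sup.mp (hTN.sup_eq_top ▸ Submodule.mem_top : v ∈ affineTangent X P ⊔ N)
    rw [← hsup] at ha
    obtain ⟨p, hp, t, ht, rfl⟩ := Submodule.mem_sup.mp ha
    rw [P.submodule_eq] at hp
    obtain ⟨s, rfl⟩ := Submodule.mem_span_singleton.mp hp
    exact ⟨(s, bT.symm ⟨t, ht⟩, bN.symm ⟨z, hz⟩), by simp [hg, add_assoc]⟩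
  let e := (LinearEquiv.ofBijective g ⟨hinj, hsurj⟩).symm
  refine ⟨_, _, e, fun c v => ?_⟩
  obtain ⟨⟨s, x, y⟩, rfl⟩ := hsurj v
  have he : ∀ z, e (g z) = z := fun z => (LinearEquiv.ofBijective g ⟨hinj, hsurj⟩).symm_apply_apply z
  have h1 : E c (g (s, x, y)) = g (s, (c : ℂ) • x, (c : ℂ) ^ 2 • y) := by
    rw [hg, hg, map_add, map_add, map_smul, (hact c).1 _ hrep, (hact c).2.1 _ (bT x).2,
      (hact c).2.2 _ (bN y).2]
    simp
  rw [h1, he, he]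

/-- Any coordinates adapted to a quadratic symmetry split `V` into the weight spaces of the symmetry,
which are determined by the action. -/
theorem IsQuadraticSymmetry.isQuadraticFrame (hE : IsQuadraticSymmetry X P E) {n m : ℕ}
    {e : V ≃ₗ[ℂ] ℂ × (Fin n → ℂ) × (Fin m → ℂ)} (he : AdaptedCoordinates E e) :
    IsQuadraticFrame X P e := by
  obtain ⟨⟨T, N, hPT, hsup, hTN, hact⟩, hX⟩ := hE
  -- the weight spaces are the eigenspaces of the single operator `E 2`
  let c : ℂˣ := Units.mk0 2 two_ne_zero
  have hc : (c : ℂ) = 2 := rfl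
  have hline : ∀ v ∈ P.submodule, (e v).2.1 = 0 ∧ (e v).2.2 = 0 := by
    intro v hv
    have h := he c v
    rw [(hact c).1 v hv, hc, Prod.ext_iff, Prod.ext_iff] at h
    obtain ⟨-, h1, h2⟩ := h
    constructor
    · funext i
      have := congrFun h1 i
      simp only [Pi.smul_apply, smul_eq_mul] at this
      simp only [Pi.zero_apply]
      linear_combination -this
    · funext i
      have := congrFun h2 i
      simp only [Pi.smul_apply, smul_eq_mul] at this
      simp only [Pi.zero_apply]
      linear_combination (-1 / 3) * this
  have hT : ∀ v ∈ T, (e v).1 = 0 ∧ (e v).2.2 = 0 := by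
    intro v hv
    have h := he c v
    rw [(hact c).2.1 v hv, hc, map_smul, Prod.ext_iff, Prod.ext_iff] at h
    obtain ⟨h0, -, h2⟩ := h
    constructor
    · simp only [Prod.smul_fst, smul_eq_mul] at h0
      linear_combination h0
    · funext i
      have := congrFun h2 i
      simp only [Prod.smul_snd, Pi.smul_apply, smul_eq_mul] at this
      simp only [Pi.zero_apply]
      linear_combination (-1 / 2) * this
  have hN : ∀ v ∈ N, (e v).1 = 0 ∧ (e v).2.1 = 0 := by
    intro v hv
    have h := he c v
    rw [(hact c).2.2 v hv, hc, map_smul, Prod.ext_iff, Prod.ext_iff] at h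
    obtain ⟨h0, h1, -⟩ := h
    constructor
    · simp only [Prod.smul_fst, smul_eq_mul] at h0
      linear_combination (1 / 3) * h0
    · funext i
      have := congrFun h1 i
      simp only [Prod.smul_fst, Prod.smul_snd, Pi.smul_apply, smul_eq_mul] at this
      simp only [Pi.zero_apply]
      linear_combination (1 / 2) * this
  have htan : ∀ v, v ∈ affineTangent X P ↔ (e v).2.2 = 0 := by
    intro v
    constructor
    · intro hv
      rw [← hsup] at hv
      obtain ⟨p, hp, t, ht, rfl⟩ := Submodule.mem_sup.mp hv
      simp [(hline p hp).2, (hT t ht).2]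
    · intro hv
      obtain ⟨a, ha, z, hz, rfl⟩ :=
        Submodule.mem_sup.mp (hTN.sup_eq_top ▸ Submodule.mem_top : v ∈ affineTangent X P ⊔ N)
      have ha' : (e a).2.2 = 0 := by
        rw [← hsup] at ha
        obtain ⟨p, hp, t, ht, rfl⟩ := Submodule.mem_sup.mp ha
        simp [(hline p hp).2, (hT t ht).2]
      have hz0 : e z = 0 := by
        refine Prod.ext (hN z hz).1 (Prod.ext (hN z hz).2 ?_)
        simpa [ha'] using hv
      rw [(LinearEquiv.map_eq_zero_iff e).mp hz0, add_zero]
      exact ha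
  refine ⟨fun v => ⟨hline v, fun hv => ?_⟩, htan, fun c hc s u w h => ?_⟩
  · have hvT := (htan v).mpr hv.2
    rw [← hsup] at hvT
    obtain ⟨p, hp, t, ht, rfl⟩ := Submodule.mem_sup.mp hvT
    have ht0 : e t = 0 := by
      refine Prod.ext (hT t ht).1 (Prod.ext ?_ (hT t ht).2)
      simpa [(hline p hp).1] using hv.1
    rw [(LinearEquiv.map_eq_zero_iff e).mp ht0, add_zero]
    exact hp
  · have h1 : e.symm (s, c • u, c ^ 2 • w) = E (Units.mk0 c hc) (e.symm (s, u, w)) := by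
      rw [LinearEquiv.symm_apply_eq, he]
      simp
    rw [h1]
    set v := e.symm (s, u, w)
    obtain ⟨Q, hQ, hv⟩ := h
    by_cases hv0 : v = 0
    · exact ⟨Q, hQ, by simp [hv0]⟩
    have hEv : E (Units.mk0 c hc) v ≠ 0 := by simpa using hv0
    rw [mem_affineCone_iff (mem_submodule_mk hEv) hEv, ← hX (Units.mk0 c hc)]
    refine ⟨Q, hQ, ?_⟩
    rw [eq_mk_of_mem hv hv0]
    rfl

end Symmetry

/-! ### Coordinates -/

section Coordinates

variable {V : Type*} [NormedAddCommGroup V] [NormedSpace ℂ V]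
  {X : Set (ℙ ℂ V)} {n m : ℕ} {e : V ≃ₗ[ℂ] ℂ × (Fin n → ℂ) × (Fin m → ℂ)}
  {B : (Fin n → ℂ) →ₗ[ℂ] (Fin n → ℂ) →ₗ[ℂ] (Fin m → ℂ)}

/-- The components of `z ↦ B(z, z)` as polynomials. -/
noncomputable def diagPolynomial (B : (Fin n → ℂ) →ₗ[ℂ] (Fin n → ℂ) →ₗ[ℂ] (Fin m → ℂ))
    (k : Fin m) : MvPolynomial (Fin n) ℂ :=
  ∑ i, ∑ j, MvPolynomial.C (B (Pi.single i 1) (Pi.single j 1) k) *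
    (MvPolynomial.X i * MvPolynomial.X j)

theorem diagPolynomial_isHomogeneous (k : Fin m) : (diagPolynomial B k).IsHomogeneous 2 := by
  refine MvPolynomial.IsHomogeneous.sum _ _ _ fun i _ =>
    MvPolynomial.IsHomogeneous.sum _ _ _ fun j _ => ?_
  have h := (MvPolynomial.isHomogeneous_C (Fin n) (B (Pi.single i 1) (Pi.single j 1) k)).mul
    ((MvPolynomial.isHomogeneous_X ℂ i).mul (MvPolynomial.isHomogeneous_X ℂ j))
  simpa using h

theorem eval_diagPolynomial (k : Fin m) (z : Fin n → ℂ) :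
    MvPolynomial.eval z (diagPolynomial B k) = B z z k := by
  have hz : z = ∑ i, z i • (Pi.single i 1 : Fin n → ℂ) := by
    conv_lhs => rw [← Finset.univ_sum_single z]
    refine Finset.sum_congr rfl fun i _ => ?_
    rw [← Pi.single_smul, smul_eq_mul, mul_one]
  have h : B z z = ∑ i, ∑ j, (z i * z j) • B (Pi.single i 1) (Pi.single j 1) := by
    conv_lhs => rw [hz]
    simp only [map_sum, LinearMap.sum_apply, map_smul, LinearMap.smul_apply, Finset.smul_sum,
      smul_smul]
    rw [Finset.sum_comm]
    simp only [mul_comm]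
  rw [h]
  simp [diagPolynomial, Finset.sum_apply, mul_comm]

theorem IsQuadraticGraph.isGraphGerm (hB : IsQuadraticGraph X e B) :
    IsGraphGerm X e fun z => B z z := by
  refine ⟨?_, Filter.Eventually.of_forall fun z => hB.mem_iff _ _⟩
  rw [analyticAt_pi_iff]
  intro k
  simp only [← eval_diagPolynomial]
  exact AnalyticOnNhd.eval_mvPolynomial _ _ trivial

/-- Two graph germs of the same set agree, as the points of one of them lie on the other. -/
theorem IsGraphGerm.eventuallyEq {F F' : (Fin n → ℂ) → (Fin m → ℂ)} (hF : IsGraphGerm X e F)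
    (hF' : IsGraphGerm X e F') (hF0 : F 0 = 0) : F' =ᶠ[𝓝 0] F := by
  have hlim : Filter.Tendsto (fun z => (z, F z)) (𝓝 0) (𝓝 (0 : (Fin n → ℂ) × (Fin m → ℂ))) := by
    have : Filter.Tendsto (fun z => (z, F z)) (𝓝 0) (𝓝 ((0 : Fin n → ℂ), F 0)) :=
      (continuousAt_id.prodMk hF.1.continuousAt).tendsto
    rwa [hF0] at this
  filter_upwards [hlim.eventually hF.2, hlim.eventually hF'.2] with z h h'
  exact (h'.mp (h.mpr rfl)).symm

/-- The system of quadrics of `σ` is spanned by the coordinates of `B`. -/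
theorem quadricSystem_eq_span {T N : Type*} [AddCommGroup T] [Module ℂ T] [AddCommGroup N]
    [Module ℂ N] {σ : T →ₗ[ℂ] T →ₗ[ℂ] N} (τ : T ≃ₗ[ℂ] (Fin n → ℂ)) (β : N ≃ₗ[ℂ] (Fin m → ℂ))
    (hσ : ∀ a b, β (σ a b) = (2 : ℂ) • B (τ a) (τ b)) :
    quadricSystem σ = Submodule.span ℂ {q | ∃ k, ∀ a, q a = B (τ a) (τ a) k} := by
  apply le_antisymm
  · intro q hq
    obtain ⟨ξ, hξ⟩ := mem_quadricSystem.mp hq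
    have hq' : q = ∑ k, (2 * ξ (β.symm (Pi.single k 1))) •
        dualQuadric (B.compl₁₂ (τ : T →ₗ[ℂ] _) (τ : T →ₗ[ℂ] _)) (LinearMap.proj k) := by
      ext a
      have h1 : σ a a = β.symm (∑ k, (2 * B (τ a) (τ a) k) • (Pi.single k 1 : Fin m → ℂ)) := by
        rw [LinearEquiv.eq_symm_apply, hσ]
        funext i
        simp [Finset.sum_apply, Pi.single_apply]
      rw [hξ, h1]
      simp [dualQuadric_apply, mul_assoc, mul_comm, mul_left_comm]
    rw [hq']
    exact Submodule.sum_mem _ fun k _ => Submodule.smul_mem _ _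
      (Submodule.subset_span ⟨k, fun a => rfl⟩)
  · rw [Submodule.span_le]
    rintro q ⟨k, hk⟩
    refine mem_quadricSystem.mpr ⟨(1 / 2 : ℂ) • (LinearMap.proj k ∘ₗ β.toLinearMap), fun a => ?_⟩
    simp [hk, hσ]

end Coordinates

/-! ### Quadratically symmetric varieties -/

section Main

variable {V : Type*} [NormedAddCommGroup V] [NormedSpace ℂ V] [FiniteDimensional ℂ V]
  {X Xo : Set (ℙ ℂ V)} {P : ℙ ℂ V}

theorem IsQuadraticFrame.exists_isQuadraticGraph {U W : Type*} [NormedAddCommGroup U]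
    [NormedSpace ℂ U] [NormedAddCommGroup W] [NormedSpace ℂ W] [FiniteDimensional ℂ U]
    [FiniteDimensional ℂ W] {e : V ≃ₗ[ℂ] ℂ × U × W} (he : IsQuadraticFrame X P e)
    (hX : IsNondegenerateVariety X) (hP : IsNonsingularPoint X P) :
    ∃ B, IsQuadraticGraph X e B := by
  obtain ⟨B, hsymm, hB⟩ := he.exists_graph hP
  exact ⟨B, hX, hsymm, hB⟩

/-- The second fundamental form in a quadratic frame: it is `2 B` in the coordinates of the
frame. -/
theorem IsQuadraticFrame.exists_secondFundamentalForm {U W : Type*} [NormedAddCommGroup U]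
    [NormedSpace ℂ U] [NormedAddCommGroup W] [NormedSpace ℂ W] {e : V ≃ₗ[ℂ] ℂ × U × W}
    (he : IsQuadraticFrame X P e) {B : U →ₗ[ℂ] U →ₗ[ℂ] W} (hB : IsQuadraticGraph X e B) :
    ∃ (σ : TangentSpaceAt X P →ₗ[ℂ] TangentSpaceAt X P →ₗ[ℂ] NormalSpaceAt X P)
      (τ : TangentSpaceAt X P ≃ₗ[ℂ] U) (β : NormalSpaceAt X P ≃ₗ[ℂ] W),
      IsSecondFundamentalForm X P σ ∧
      (∀ (a : TangentSpaceAt X P) (p : P.submodule) (u : affineTangent X P),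
        a p = Submodule.Quotient.mk u → (e (u : V)).2.1 = (e (p : V)).1 • τ a) ∧
      ∀ a b, β (σ a b) = (2 : ℂ) • B (τ a) (τ b) := by
  obtain ⟨τ, hτ⟩ := he.exists_tangentEquiv
  obtain ⟨β, hβ⟩ := he.exists_normalEquiv
  have hσ : ∀ a b, β ((((2 : ℂ) • B).compl₁₂ (τ : TangentSpaceAt X P →ₗ[ℂ] U)
      (τ : TangentSpaceAt X P →ₗ[ℂ] U)).compr₂ (β.symm : W →ₗ[ℂ] NormalSpaceAt X P) a b) =
      (2 : ℂ) • B (τ a) (τ b) := fun a b => by simp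
  exact ⟨_, τ, β, he.isSecondFundamentalForm hB hτ hβ hσ, hτ, hσ⟩

theorem IsQuadraticallySymmetric.exists_frame (hX : IsQuadraticallySymmetric X Xo) (hP : P ∈ Xo) :
    ∃ (n m : ℕ) (e : V ≃ₗ[ℂ] ℂ × (Fin n → ℂ) × (Fin m → ℂ))
      (B : (Fin n → ℂ) →ₗ[ℂ] (Fin n → ℂ) →ₗ[ℂ] (Fin m → ℂ)),
      IsQuadraticFrame X P e ∧ IsQuadraticGraph X e B := by
  obtain ⟨E, hE⟩ := hX.symmetric P hP
  obtain ⟨n, m, e, he⟩ := hE.exists_adapted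
  have hfr := hE.isQuadraticFrame he
  obtain ⟨B, hB⟩ := hfr.exists_isQuadraticGraph hX.variety (hX.nonsingular P hP)
  exact ⟨n, m, e, B, hfr, hB⟩

/-- The second fundamental form at a point of a quadratically symmetric variety is surjective and
determines the variety: `X` is equivalent to `Z(σ')` for every form `σ'` isomorphic to `σ`. -/
theorem IsQuadraticallySymmetric.secondFundamentalForm (hX : IsQuadraticallySymmetric X Xo)
    (hP : P ∈ Xo) {σ : TangentSpaceAt X P →ₗ[ℂ] TangentSpaceAt X P →ₗ[ℂ] NormalSpaceAt X P}
    (hσ : IsSecondFundamentalForm X P σ) :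
    (∀ a b, σ a b = σ b a) ∧
    (∀ ξ : Module.Dual ℂ (NormalSpaceAt X P), (∀ a, ξ (σ a a) = 0) → ξ = 0) ∧
    ∀ {T N : Type _} [AddCommGroup T] [Module ℂ T] [AddCommGroup N] [Module ℂ N]
      (τ : TangentSpaceAt X P ≃ₗ[ℂ] T) (ν : NormalSpaceAt X P ≃ₗ[ℂ] N)
      (σ' : T →ₗ[ℂ] T →ₗ[ℂ] N), (∀ a, σ' (τ a) (τ a) = ν (σ a a)) →
      ProjectivelyEquivalent X (quadricImage σ') := by
  obtain ⟨n, m, e, B, he, hB⟩ := hX.exists_frame hP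
  obtain ⟨σ₀, τ₀, β, hσ₀, -, h⟩ := he.exists_secondFundamentalForm hB
  obtain rfl := he.secondFundamentalForm_unique hB hσ hσ₀
  refine ⟨fun a b => ?_, fun ξ hξ => ?_, fun τ ν σ' hσ' => ?_⟩
  · apply β.injective
    rw [h, h, hB.symm]
  · have h0 : ξ ∘ₗ (β.symm : _ →ₗ[ℂ] NormalSpaceAt X P) = 0 := hB.dual_eq_zero fun u => by
      have h1 := hξ (τ₀.symm u)
      have h2 : σ (τ₀.symm u) (τ₀.symm u) = (2 : ℂ) • β.symm (B u u) := by
        rw [← map_smul, LinearEquiv.eq_symm_apply, h]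
        simp
      rw [h2, map_smul] at h1
      simpa using h1
    ext x
    simpa using congrArg (fun l => l (β x)) h0
  · -- the factor `2` between `σ` and `B` is absorbed by a homothety of the summand `W`
    refine hB.projectivelyEquivalent (τ₀.symm.trans τ)
      (((LinearEquiv.smulOfNeZero ℂ _ (2 : ℂ) two_ne_zero).trans β.symm).trans ν) fun u => ?_
    have h2 : σ (τ₀.symm u) (τ₀.symm u) = β.symm ((2 : ℂ) • B u u) := by
      rw [LinearEquiv.eq_symm_apply, h]
      simp
    simp only [LinearEquiv.trans_apply]
    rw [hσ', h2]
    rfl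

end Main

end QuadSym

theorem proposition6 {V : Type*} [NormedAddCommGroup V] [NormedSpace ℂ V]
    [FiniteDimensional ℂ V] :
    (∀ X Xo : Set (ℙ ℂ V), QuadSym.IsQuadraticallySymmetric X Xo → ∀ P ∈ Xo,
      ∃ σ : QuadSym.TangentSpaceAt X P →ₗ[ℂ] QuadSym.TangentSpaceAt X P →ₗ[ℂ]
          QuadSym.NormalSpaceAt X P,
        -- `σ` is the second fundamental form of `X` at `P`, which is well defined,
        QuadSym.IsSecondFundamentalForm X P σ ∧
        (∀ σ', QuadSym.IsSecondFundamentalForm X P σ' → σ' = σ) ∧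
        -- it is a surjective linear map from the symmetric square of the tangent space,
        (∀ a b, σ a b = σ b a) ∧
        Function.Surjective (TensorProduct.lift σ) ∧
        -- and `X` is projectively equivalent to `Z(σ)`;
        QuadSym.ProjectivelyEquivalent X (QuadSym.quadricImage σ) ∧
        -- in coordinates adapted to the action, the germ of `X` at `P` is the graph of
        -- homogeneous quadratic polynomials, whose linear system is that of `σ`.
        ∀ E : ℂˣ →* (V ≃ₗ[ℂ] V), QuadSym.IsQuadraticSymmetry X P E →
          ∀ (n m : ℕ) (e : V ≃ₗ[ℂ] ℂ × (Fin n → ℂ) × (Fin m → ℂ)),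
            QuadSym.AdaptedCoordinates E e →
            (∃ F, QuadSym.IsGraphGerm X e F) ∧
            ∀ F, QuadSym.IsGraphGerm X e F →
              ∃ G : Fin m → MvPolynomial (Fin n) ℂ,
                (∀ k, (G k).IsHomogeneous 2) ∧
                (∀ᶠ z in 𝓝 (0 : Fin n → ℂ), ∀ k, F z k = MvPolynomial.eval z (G k)) ∧
                ∃ τ : QuadSym.TangentSpaceAt X P ≃ₗ[ℂ] (Fin n → ℂ),
                  QuadSym.IsCoordinateIdentification X P e τ ∧
                  QuadSym.quadricSystem σ = Submodule.span ℂ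
                    {q | ∃ k, ∀ a, q a = MvPolynomial.eval (τ a) (G k)}) ∧
    -- two quadratically symmetric varieties with isomorphic second fundamental forms
    -- are projectively equivalent
    (∀ X₁ X₁o X₂ X₂o : Set (ℙ ℂ V),
      QuadSym.IsQuadraticallySymmetric X₁ X₁o → QuadSym.IsQuadraticallySymmetric X₂ X₂o →
      ∀ P₁ ∈ X₁o, ∀ P₂ ∈ X₂o, ∀ σ₁ σ₂,
        QuadSym.IsSecondFundamentalForm X₁ P₁ σ₁ → QuadSym.IsSecondFundamentalForm X₂ P₂ σ₂ →
        QuadSym.SystemsIsomorphic σ₁ σ₂ → QuadSym.ProjectivelyEquivalent X₁ X₂) := by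
  refine ⟨fun X Xo hX P hP => ?_, fun X₁ X₁o X₂ X₂o hX₁ hX₂ P₁ hP₁ P₂ hP₂ σ₁ σ₂ hσ₁ hσ₂ hiso => ?_⟩
  · obtain ⟨n, m, e, B, he, hB⟩ := hX.exists_frame hP
    obtain ⟨σ, -, -, hσ, -, -⟩ := he.exists_secondFundamentalForm hB
    obtain ⟨hsymm, hdual, hZ⟩ := hX.secondFundamentalForm hP hσ
    refine ⟨σ, hσ, fun σ' hσ' => he.secondFundamentalForm_unique hB hσ' hσ, hsymm,
      QuadSym.surjective_lift_of_dual hdual,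
      hZ (LinearEquiv.refl ℂ _) (LinearEquiv.refl ℂ _) σ fun _ => rfl, ?_⟩
    clear! n
    intro E hE n m e he
    have hfr := hE.isQuadraticFrame he
    obtain ⟨B, hB⟩ := hfr.exists_isQuadraticGraph hX.variety (hX.nonsingular P hP)
    obtain ⟨σ', τ, β, hσ', hτ, h⟩ := hfr.exists_secondFundamentalForm hB
    obtain rfl := hfr.secondFundamentalForm_unique hB hσ' hσ
    refine ⟨⟨_, hB.isGraphGerm⟩, fun F hF => ⟨QuadSym.diagPolynomial B,
      QuadSym.diagPolynomial_isHomogeneous, ?_, τ, hτ, ?_⟩⟩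
    · filter_upwards [hB.isGraphGerm.eventuallyEq hF (by simp)] with z hz k
      rw [hz, QuadSym.eval_diagPolynomial]
    · simp only [QuadSym.eval_diagPolynomial]
      exact QuadSym.quadricSystem_eq_span τ β h
  · obtain ⟨-, hdual₁, hZ₁⟩ := hX₁.secondFundamentalForm hP₁ hσ₁
    obtain ⟨-, hdual₂, hZ₂⟩ := hX₂.secondFundamentalForm hP₂ hσ₂
    obtain ⟨τ, ν, hτν⟩ := QuadSym.exists_equiv_of_systemsIsomorphic hdual₁ hdual₂ hiso
    exact (hZ₁ τ ν σ₂ hτν).trans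
      (hZ₂ (LinearEquiv.refl ℂ _) (LinearEquiv.refl ℂ _) σ₂ fun _ => rfl).symm
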